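/- **Theorem 9 (Recovery of sparse tool synergies via hierarchical penalties).** *Model.* Let $M\ge 2$ be the number of tools, $T\ge 1$ the number of time steps, $q$ the block dimension. A parameter $\vartheta=(\theta,\beta)$ consists of main-effect blocks $\theta_i\in\mathbb R^q$ ($1\le i\le M$) and interaction blocks $\beta_{ij}\in\mathbb R^q$ ($1\le i<j\le M$). For block vectors let $\|\cdot\|_2$ be the Euclidean norm of all blocks concatenated, $\|\cdot\|_{1,2}$ the sum and $\|\cdot\|_{\infty,2}$ the maximum of the Euclidean norms of the blocks. Data $(z_t,y_t)_{t<T}$, with features $z_t=(w_t,u_t)$ (one block in $\mathbb R^q$ for each main effect and each pair), follow $$y_t=\sum_j\langle\theta^\star_j,(w_t)_j\rangle+\sum_{i<j}\langle\beta^\star_{ij},(u_t)_{ij}\rangle+\xi_t ,$$ where, for a filtration $(\mathcal F_t)$, $z_t$ is $\mathcal F_t$-measurable, $y_t$ is $\mathcal F_{t+1}$-measurable, every block of $z_t$ has norm at most $1$ almost surely, and, given $\mathcal F_t$, $\xi_t$ is centred and sub-Gaussian with variance proxy $\sigma^2$. Let $\widehat{\mathcal L}_T(\vartheta)=\frac1{2T}\sum_t(y_t-\langle\vartheta,z_t\rangle)^2$,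 $\mathcal L=\mathbb E\,\widehat{\mathcal L}_T$, $\widehat H=\nabla^2\widehat{\mathcal L}_T(\vartheta^\star)$, $H=\nabla^2\mathcal L(\vartheta^\star)$. Let $S$ be the set of nonzero blocks of $\vartheta^\star=(\theta^\star,\beta^\star)$; it contains $k_1$ main effects and $k_2$ interactions and satisfies heredity: $\beta^\star_{ij}\ne0$ implies $\theta^\star_i\neq0$ and $\theta^\star_j\ne0$. *Penalty.* For each tool $i$ let $g_i$ be the group made of $\theta_i$ and all interaction blocks that involve $i$. For levels $\lambda_i,\lambda_{ij}>0$ let $$\mathcal R(\vartheta)=\sum_i\lambda_i\|\vartheta_{g_i}\|_2+\sum_{i<j}\lambda_{ij}\|\beta_{ij}\|_2 ,$$ let $\mathcal R^{c}_S$ be the same sum restricted to the groups (the $g_i$ and the single interactions) that are disjoint from $S$, and let $\hat\vartheta=(\hat\theta,\hat\beta)$ be any minimizer of $\widehat{\mathcal L}_T+\mathcal R$. *Assumptions* (with constants $\mu,D,\eta>0$, $\alpha\in(0,1]$, $\delta\in(0,1)$, $\delta_H\ge 0$): 1. (Hierarchical RSC) $\mathcal L(\vartheta^\star+\Delta)\ge\mathcal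 L(\vartheta^\star)+\langle\nabla\mathcal L(\vartheta^\star),\Delta\rangle+\frac\mu2\|\Delta\|_2^2$ for all $\Delta$ with $\mathcal R^c_S(\Delta)\le 3\,\mathcal R(\Delta_S)$. 2. (Hierarchical incoherence) If $r$ is supported on $S$ and $\langle r,x\rangle\le\mathcal R(x)$ for all $x$ supported on $S$, then $\langle H_{S^c,S}(H_{S,S})^{-1}r,x\rangle\le(1-\alpha)\,\mathcal R^c_S(x)$ for all $x$ supported on $S^c$. 3. $\|(H_{S,S})^{-1}\|_{\infty,2\to\infty,2}\le D$, and (Hessian stability) with probability at least $1-\delta_H$, $\|(\widehat H-H)_{\cdot,S}\|_{\infty,2\to\infty,2}\le\eta$. *Claim.* There is $c_0>0$ depending only on $(q,\sigma,\delta,\alpha)$ such that for all $A\ge c_0$ there is $C>0$, depending only on these, $A$ and $\mu$, such that for all $D,\rho>0$ there are $C_1,C_2,\eta>0$, depending only on all the preceding constants (and not on $M,T,k_1,k_2$, the probability space or the distribution of the data), for which the following holds. Suppose that the model and assumptions 1–3 hold, that every level of $\mathcal R$ lies between $c_0\sqrt{(\log M)/T}$ and $A\sqrt{(\log M)/T}$,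 that every nonzero block of $\vartheta^\star$ has norm at least $C_2\sqrt{(\log M)/T}$, and that $$T\ \ge\ C_1\,(k_1+k_2)\log M .$$ Then, with probability at least $1-\delta-\delta_H$, a minimizer $\hat\vartheta$ exists, and every minimizer has exactly the same main-effect support and the same interaction support as $\vartheta^\star$ and satisfies $$\|(\hat\theta,\hat\beta)-(\theta^\star,\beta^\star)\|_2\ \le\ C\sqrt{\frac{(k_1+k_2)\log M}{T}} ;$$ moreover, for every value function $V$ of the parameter and $L_V>0$: if $|V(\vartheta)-V(\vartheta^\star)|\le L_V\|\vartheta-\vartheta^\star\|_2$ whenever $\|\vartheta-\vartheta^\star\|_2<\rho$, then $V(\vartheta^\star)-V(\hat\vartheta)\le L_VC\sqrt{(k_1+k_2)\log M/T}$; if $|V(\vartheta)-V(\vartheta^\star)|\le L_V\|\vartheta-\vartheta^\star\|_{1,2}$ whenever $\|\vartheta-\vartheta^\star\|_2<\rho$, then $V(\vartheta^\star)-V(\hat\vartheta)\le L_VC\,(k_1+k_2)\sqrt{(\log M)/T}$. -/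

import Mathlib

open MeasureTheory

noncomputable section

namespace SparseSynergy

/-- Block index set: a main-effect block for each tool `i`, and an interaction block for each
pair of tools `i < j`. -/
abbrev Block (M : ℕ) : Type := Fin M ⊕ {p : Fin M × Fin M // p.1 < p.2}

/-- Block vectors `(θ, β)` with `θ_i = ϑ (Sum.inl i) ∈ ℝ^q` and `β_{ij} = ϑ (Sum.inr (i, j)) ∈ ℝ^q`.
The norm of this type is the Euclidean norm of the concatenation of all blocks. -/
abbrev Param (M q : ℕ) : Type := PiLp 2 (fun _ : Block M => EuclideanSpace ℝ (Fin q))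

variable {M q : ℕ}

/-- The set of nonzero blocks (active main effects and active interactions). -/
def blockSupp (ϑ : Param M q) : Set (Block M) := {b | ϑ b ≠ 0}

/-- The active main effects. -/
def mainSupp (ϑ : Param M q) : Set (Fin M) := {i | ϑ (Sum.inl i) ≠ 0}

/-- The active pairwise interactions. -/
def interSupp (ϑ : Param M q) : Set {p : Fin M × Fin M // p.1 < p.2} := {p | ϑ (Sum.inr p) ≠ 0}

/-- Strong heredity: an active interaction has both of its main effects active. -/
def Heredity (ϑ : Param M q) : Prop :=
  ∀ p : {p : Fin M × Fin M // p.1 < p.2}, ϑ (Sum.inr p) ≠ 0 →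
    ϑ (Sum.inl p.1.1) ≠ 0 ∧ ϑ (Sum.inl p.1.2) ≠ 0

/-- Keep the blocks in `S`, set the other blocks to zero. -/
def restr (S : Set (Block M)) (v : Param M q) : Param M q :=
  WithLp.toLp 2 (S.indicator (fun b => v b))

/-- The mixed norm `‖v‖_{1,2}`: sum of the Euclidean norms of the blocks. -/
def norm12 (v : Param M q) : ℝ := ∑ b, ‖v b‖

/-- The mixed norm `‖v‖_{∞,2}`: maximum of the Euclidean norms of the blocks
(the norm on the right is the sup norm of a finite product). -/
def normInf2 (v : Param M q) : ℝ := ‖(fun b => v b : Block M → EuclideanSpace ℝ (Fin q))‖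

/-- The hierarchical group of tool `i`: its main effect with all interactions that involve `i`. -/
def starGroup (i : Fin M) : Set (Block M) :=
  {b | b = Sum.inl i ∨ ∃ p, b = Sum.inr p ∧ (p.1.1 = i ∨ p.1.2 = i)}

/-- The hierarchical overlapping group penalty
`∑_i lam_i ‖(θ_i, (β_{ij})_j)‖₂ + ∑_{i<j} lam_{ij} ‖β_{ij}‖₂`. Removing the main effect `i`
removes the whole group of `i`, so that the zero patterns are the hereditary ones. -/
def hierPenalty (lam : Block M → ℝ) (v : Param M q) : ℝ :=
  ∑ i, lam (Sum.inl i) * ‖restr (starGroup i) v‖ + ∑ p, lam (Sum.inr p) * ‖v (Sum.inr p)‖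

open scoped Classical in
/-- The part of the penalty that is carried by the groups disjoint from `S`. It is the directional
derivative of the penalty, at a point with hereditary support `S`, in directions supported on
`Sᶜ`. -/
def hierPenaltyOff (lam : Block M → ℝ) (S : Set (Block M)) (v : Param M q) : ℝ :=
  ∑ i, (if Disjoint (starGroup i) S then lam (Sum.inl i) * ‖restr (starGroup i) v‖ else 0) +
    ∑ p, (if Sum.inr p ∈ S then 0 else lam (Sum.inr p) * ‖v (Sum.inr p)‖)

/-- The cone induced by the hierarchical penalty at the support `S`. -/
def hierCone (lam : Block M → ℝ) (S : Set (Block M)) : Set (Param M q) :=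
  {Δ | hierPenaltyOff lam S Δ ≤ 3 * hierPenalty lam (restr S Δ)}

/-- The quadratic surrogate with interactions: `z_t = (w_t, u_t)` collects the main-effect features
and the interaction features, and
`⟪ϑ, z_t⟫ = ∑_j ⟪θ_j, (w_t)_j⟫ + ∑_{i<j} ⟪β_{ij}, (u_t)_{ij}⟫`. -/
def empLoss (T : ℕ) (y : ℕ → ℝ) (z : ℕ → Param M q) (ϑ : Param M q) : ℝ :=
  1 / (2 * (T : ℝ)) * ∑ t ∈ Finset.range T, (y t - inner ℝ ϑ (z t)) ^ 2

/-- The population loss, the expectation of the quadratic surrogate. -/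
def popLoss {Ω : Type*} [MeasurableSpace Ω] (P : Measure Ω) (T : ℕ) (y : ℕ → Ω → ℝ)
    (z : ℕ → Ω → Param M q) (ϑ : Param M q) : ℝ :=
  ∫ ω, empLoss T (fun t => y t ω) (fun t => z t ω) ϑ ∂P

/-- The Hessian of a function of the block vector, as an operator. -/
def hess (L : Param M q → ℝ) (ϑ : Param M q) : Param M q →L[ℝ] Param M q :=
  fderiv ℝ (gradient L) ϑ

/-- Sequential data from the linear model with interactions
`y_t = ⟪ϑ, z_t⟫ + ξ_t`, `t < T`: `ℱ t` is the information available when `y_t` is generated, the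
features are known at that time and bounded by one in each block, and the noise
`ξ_t = y_t - ⟪ϑ, z_t⟫` is conditionally centred and conditionally sub-Gaussian with variance
proxy `σ²`. -/
structure IsSynergyModel {Ω : Type*} [mΩ : MeasurableSpace Ω] (P : Measure Ω)
    (ℱ : Filtration ℕ mΩ) (T : ℕ) (y : ℕ → Ω → ℝ) (z : ℕ → Ω → Param M q)
    (ϑ : Param M q) (σ : ℝ) : Prop where
  measurable_feature : ∀ t < T, StronglyMeasurable[ℱ t] (z t)
  measurable_response : ∀ t < T, StronglyMeasurable[ℱ (t + 1)] (y t)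
  bounded_feature : ∀ t < T, ∀ᵐ ω ∂P, ∀ b, ‖z t ω b‖ ≤ 1
  noise_centred : ∀ t < T, P[fun ω => y t ω - inner ℝ ϑ (z t ω) | ℱ t] =ᵐ[P] 0
  noise_integrable : ∀ t < T, ∀ s : ℝ,
    Integrable (fun ω => Real.exp (s * (y t ω - inner ℝ ϑ (z t ω)))) P
  noise_subgaussian : ∀ t < T, ∀ s : ℝ,
    P[fun ω => Real.exp (s * (y t ω - inner ℝ ϑ (z t ω))) | ℱ t]
      ≤ᵐ[P] fun _ => Real.exp (σ ^ 2 * s ^ 2 / 2)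

/-- Restricted strong convexity of `L` at `ϑ` with constant `μ` on the hierarchical cone. -/
def HierRSC (L : Param M q → ℝ) (ϑ : Param M q) (lam : Block M → ℝ) (μ : ℝ) : Prop :=
  ∀ Δ ∈ hierCone lam (blockSupp ϑ),
    L ϑ + inner ℝ (gradient L ϑ) Δ + μ / 2 * ‖Δ‖ ^ 2 ≤ L (ϑ + Δ)

/-- Irrepresentability with margin `α` on the support `S` for the hierarchical penalty:
`H_{Sᶜ,S} (H_{S,S})⁻¹` maps the unit ball of the dual norm of the penalty on `S` into `1 - α` times
the polar of the unit ball of `hierPenaltyOff` on `Sᶜ`. Here `a` is `(H_{S,S})⁻¹ r`, so that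
`r` is the `S`-part of `H a`. -/
def HierIncoherent (H : Param M q →L[ℝ] Param M q) (S : Set (Block M)) (lam : Block M → ℝ)
    (α : ℝ) : Prop :=
  ∀ a : Param M q, blockSupp a ⊆ S →
    (∀ x : Param M q, blockSupp x ⊆ S → inner ℝ (H a) x ≤ hierPenalty lam x) →
    ∀ x : Param M q, blockSupp x ⊆ Sᶜ → inner ℝ (H a) x ≤ (1 - α) * hierPenaltyOff lam S x

/-- `‖(H_{S,S})⁻¹‖_{∞,2 → ∞,2} ≤ D`. -/
def InvBound (H : Param M q →L[ℝ] Param M q) (S : Set (Block M)) (D : ℝ) : Prop :=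
  ∀ a : Param M q, blockSupp a ⊆ S → normInf2 a ≤ D * normInf2 (restr S (H a))

/-- `‖(H' - H)_{·,S}‖_{∞,2 → ∞,2} ≤ η`: the columns of the two Hessians in `S` are close. -/
def HessClose (H' H : Param M q →L[ℝ] Param M q) (S : Set (Block M)) (η : ℝ) : Prop :=
  ∀ a : Param M q, blockSupp a ⊆ S → normInf2 (H' a - H a) ≤ η * normInf2 a

/-- `ϑhat` minimizes the surrogate plus the hierarchical penalty. -/
def IsHierEstimator (T : ℕ) (y : ℕ → ℝ) (z : ℕ → Param M q) (lam : Block M → ℝ)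
    (ϑhat : Param M q) : Prop :=
  IsMinOn (fun ϑ => empLoss T y z ϑ + hierPenalty lam ϑ) Set.univ ϑhat

end SparseSynergy

end

open SparseSynergy

/-!
The proof is a primal-dual witness argument, run on the event that the score
`g = T⁻¹ ∑_t ξ_t z_t` is small in each block and the Hessian is stable. Write `l = √(log M / T)`
and `S` for the support of `ϑ`.

*Noise.* A coordinate of `T g` is a martingale transform of the noise with predictable weights in
`[-1, 1]`. Convexity of the exponential reduces such a weight to the deterministic weights `±1`
(`lintegral_mul_exp_le`), so the Chernoff bound for sub-Gaussian sums applies. There are at most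
`2 M² q` coordinates, hence for a large constant `c₀` all blocks of `g` have norm at most
`(α / 8) c₀ l`, except with probability `δ` (`IsSynergyModel.measure_score_le`, `union_bound_le`).

*Restricted estimator.* Let `v` minimize the objective over the parameters supported on `S`. Its
score `g - Ĥ (v - ϑ)` is dominated by the penalty on `S` (`inner_score_le_hierPenalty`); since each
block lies in at most three groups, its blocks in `S` are at most three times the largest level.
The bound on `H_{S,S}⁻¹` then controls `v - ϑ` blockwise (`normInf2_sub_le`). Hence the fluctuation
`(Ĥ - H) (v - ϑ)` is as small as the noise, and strong convexity gives the Euclidean bound with a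
constant that does not involve `D` (`mul_norm_sub_le`).

*No false positives.* The scaled error lies in the dual ball of the penalty on `S`, so that
incoherence bounds the score of `v` off `S` by `1 - α / 2` times the off-support penalty
(`inner_score_le_off`). Deleting blocks outside `S` never increases a group norm, which makes the
penalty decomposable (`hierPenalty_add_restr_add_off_le`), and heredity makes the off-support
penalty definite. So `v` is a global minimizer and every global minimizer is supported on `S`
(`objective_add_le`, `recovery_of_small_score`); the blockwise bound and the signal strength then
exclude false negatives.

Both losses are exactly quadratic, which identifies the Hessians in the hypotheses with the second
moment operators of the features (`hess_empLoss`, `IsSynergyModel.popLoss_eq_taylor`).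
-/

namespace SparseSynergy

variable {M q : ℕ}

/-! ### Block restrictions and mixed norms -/

lemma restr_apply (S : Set (Block M)) (v : Param M q) (b : Block M) :
    restr S v b = S.indicator (fun b => v b) b := rfl

lemma restr_of_mem {S : Set (Block M)} {b : Block M} (h : b ∈ S) (v : Param M q) :
    restr S v b = v b := by
  rw [restr_apply, Set.indicator_of_mem h]

lemma restr_of_notMem {S : Set (Block M)} {b : Block M} (h : b ∉ S) (v : Param M q) :
    restr S v b = 0 := by
  rw [restr_apply, Set.indicator_of_notMem h]

lemma restr_add (S : Set (Block M)) (v w : Param M q) :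
    restr S (v + w) = restr S v + restr S w := by
  ext b k
  by_cases h : b ∈ S <;> simp [restr_apply, h]

lemma restr_smul (S : Set (Block M)) (c : ℝ) (v : Param M q) :
    restr S (c • v) = c • restr S v := by
  ext b k
  by_cases h : b ∈ S <;> simp [restr_apply, h]

lemma restr_neg (S : Set (Block M)) (v : Param M q) : restr S (-v) = -restr S v := by
  simpa using restr_smul S (-1) v

lemma blockSupp_restr_subset (S : Set (Block M)) (v : Param M q) : blockSupp (restr S v) ⊆ S := by
  intro b hb
  by_contra h
  exact hb (restr_of_notMem h v)

lemma eq_zero_of_notMem {S : Set (Block M)} {v : Param M q} (hv : blockSupp v ⊆ S) {b : Block M}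
    (hb : b ∉ S) : v b = 0 := by
  by_contra h
  exact hb (hv h)

lemma restr_eq_self {S : Set (Block M)} {v : Param M q} (hv : blockSupp v ⊆ S) :
    restr S v = v := by
  ext b k
  by_cases h : b ∈ S
  · rw [restr_of_mem h]
  · rw [restr_of_notMem h, eq_zero_of_notMem hv h]

lemma restr_add_restr_compl (S : Set (Block M)) (v : Param M q) :
    restr S v + restr Sᶜ v = v := by
  ext b k
  by_cases h : b ∈ S <;> simp [restr_apply, h]

lemma blockSupp_add_subset {S : Set (Block M)} {v w : Param M q} (hv : blockSupp v ⊆ S)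
    (hw : blockSupp w ⊆ S) : blockSupp (v + w) ⊆ S := by
  intro b hb
  by_contra h
  exact hb (by simp [eq_zero_of_notMem hv h, eq_zero_of_notMem hw h])

lemma blockSupp_smul_subset {S : Set (Block M)} {v : Param M q} (c : ℝ) (hv : blockSupp v ⊆ S) :
    blockSupp (c • v) ⊆ S := by
  intro b hb
  by_contra h
  exact hb (by simp [eq_zero_of_notMem hv h])

lemma blockSupp_neg_subset {S : Set (Block M)} {v : Param M q} (hv : blockSupp v ⊆ S) :
    blockSupp (-v) ⊆ S := by
  simpa using blockSupp_smul_subset (-1) hv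

lemma blockSupp_sub_subset {S : Set (Block M)} {v w : Param M q} (hv : blockSupp v ⊆ S)
    (hw : blockSupp w ⊆ S) : blockSupp (v - w) ⊆ S := by
  simpa [sub_eq_add_neg] using blockSupp_add_subset hv (blockSupp_neg_subset hw)

lemma norm_le_of_blocks {v w : Param M q} (h : ∀ b, ‖v b‖ ≤ ‖w b‖) : ‖v‖ ≤ ‖w‖ := by
  refine (sq_le_sq₀ (norm_nonneg _) (norm_nonneg _)).1 ?_
  rw [PiLp.norm_sq_eq_of_L2, PiLp.norm_sq_eq_of_L2]
  exact Finset.sum_le_sum fun b _ => pow_le_pow_left₀ (norm_nonneg _) (h b) 2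

lemma norm12_nonneg (v : Param M q) : 0 ≤ norm12 v := Finset.sum_nonneg fun _ _ => norm_nonneg _

lemma norm12_neg (v : Param M q) : norm12 (-v) = norm12 v := by
  simp only [norm12, PiLp.neg_apply, norm_neg]

lemma norm_le_norm12 (v : Param M q) : ‖v‖ ≤ norm12 v := by
  refine (sq_le_sq₀ (norm_nonneg _) (norm12_nonneg v)).1 ?_
  rw [PiLp.norm_sq_eq_of_L2]
  exact Finset.sum_sq_le_sq_sum_of_nonneg fun _ _ => norm_nonneg _

lemma norm12_le_sqrt_ncard_mul {S : Set (Block M)} {v : Param M q} (hv : blockSupp v ⊆ S) :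
    norm12 v ≤ √(S.ncard : ℝ) * ‖v‖ := by
  classical
  have h1 : norm12 v = ∑ b ∈ S.toFinset, ‖v b‖ := by
    refine (Finset.sum_subset (Finset.subset_univ _) fun b _ hb => ?_).symm
    rw [eq_zero_of_notMem hv (by simpa using hb), norm_zero]
  have h2 : ∑ b ∈ S.toFinset, ‖v b‖ ^ 2 ≤ ‖v‖ ^ 2 := by
    rw [PiLp.norm_sq_eq_of_L2]
    exact Finset.sum_le_sum_of_subset_of_nonneg (Finset.subset_univ _) fun _ _ _ => by positivity
  refine (sq_le_sq₀ (norm12_nonneg v) (by positivity)).1 ?_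
  rw [mul_pow, Real.sq_sqrt (by positivity), h1, Set.ncard_eq_toFinset_card']
  exact sq_sum_le_card_mul_sum_sq.trans (by gcongr)

lemma norm_apply_le_normInf2 (v : Param M q) (b : Block M) : ‖v b‖ ≤ normInf2 v :=
  norm_le_pi_norm (fun b => v b) b

lemma normInf2_nonneg (v : Param M q) : 0 ≤ normInf2 v := norm_nonneg _

lemma normInf2_le {v : Param M q} {c : ℝ} (hc : 0 ≤ c) (h : ∀ b, ‖v b‖ ≤ c) : normInf2 v ≤ c :=
  (pi_norm_le_iff_of_nonneg hc).2 h

lemma inner_le_mul_norm12 {u : Param M q} {c : ℝ} (hu : ∀ b, ‖u b‖ ≤ c) (v : Param M q) :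
    inner ℝ u v ≤ c * norm12 v := by
  rw [PiLp.inner_apply, norm12, Finset.mul_sum]
  refine Finset.sum_le_sum fun b _ => (real_inner_le_norm _ _).trans ?_
  gcongr
  exact hu b

lemma norm12_restr_singleton (b : Block M) (v : Param M q) : norm12 (restr {b} v) = ‖v b‖ := by
  rw [norm12, Finset.sum_eq_single b]
  · rw [restr_of_mem (Set.mem_singleton b)]
  · intro c _ hc
    rw [restr_of_notMem (by simpa using hc), norm_zero]
  · simp

lemma inner_restr_singleton (b : Block M) (v : Param M q) :
    inner ℝ v (restr {b} v) = ‖v b‖ ^ 2 := by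
  rw [PiLp.inner_apply, Finset.sum_eq_single b]
  · rw [restr_of_mem (Set.mem_singleton b), real_inner_self_eq_norm_sq]
  · intro c _ hc
    rw [restr_of_notMem (by simpa using hc), inner_zero_right]
  · simp

lemma ncard_blockSupp (v : Param M q) :
    (blockSupp v).ncard = (mainSupp v).ncard + (interSupp v).ncard := by
  have h : blockSupp v = Sum.inl '' mainSupp v ∪ Sum.inr '' interSupp v := by
    ext (i | p) <;> simp [blockSupp, mainSupp, interSupp]
  rw [h, Set.ncard_union_eq, Set.ncard_image_of_injective _ Sum.inl_injective,
    Set.ncard_image_of_injective _ Sum.inr_injective]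
  rw [Set.disjoint_left]
  rintro _ ⟨i, _, rfl⟩ ⟨p, _, h⟩
  cases h

/-! ### The hierarchical penalty -/

lemma hierPenalty_nonneg {lam : Block M → ℝ} (h : ∀ b, 0 ≤ lam b) (v : Param M q) :
    0 ≤ hierPenalty lam v :=
  add_nonneg (Finset.sum_nonneg fun _ _ => mul_nonneg (h _) (norm_nonneg _))
    (Finset.sum_nonneg fun _ _ => mul_nonneg (h _) (norm_nonneg _))

lemma hierPenalty_add_le {lam : Block M → ℝ} (h : ∀ b, 0 ≤ lam b) (v w : Param M q) :
    hierPenalty lam (v + w) ≤ hierPenalty lam v + hierPenalty lam w := by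
  unfold hierPenalty
  rw [add_add_add_comm, ← Finset.sum_add_distrib, ← Finset.sum_add_distrib]
  refine add_le_add (Finset.sum_le_sum fun i _ => ?_) (Finset.sum_le_sum fun p _ => ?_)
  · rw [← mul_add, restr_add]
    exact mul_le_mul_of_nonneg_left (norm_add_le _ _) (h _)
  · rw [← mul_add]
    exact mul_le_mul_of_nonneg_left (norm_add_le _ _) (h _)

lemma hierPenalty_smul (lam : Block M → ℝ) {c : ℝ} (hc : 0 ≤ c) (v : Param M q) :
    hierPenalty lam (c • v) = c * hierPenalty lam v := by
  unfold hierPenalty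
  rw [mul_add, Finset.mul_sum, Finset.mul_sum]
  congr 1
  · refine Finset.sum_congr rfl fun i _ => ?_
    rw [restr_smul, norm_smul, Real.norm_of_nonneg hc, mul_left_comm]
  · refine Finset.sum_congr rfl fun p _ => ?_
    rw [PiLp.smul_apply, norm_smul, Real.norm_of_nonneg hc, mul_left_comm]

lemma hierPenalty_neg (lam : Block M → ℝ) (v : Param M q) :
    hierPenalty lam (-v) = hierPenalty lam v := by
  simp only [hierPenalty, restr_neg, norm_neg, PiLp.neg_apply]

lemma continuous_restr (S : Set (Block M)) : Continuous (restr S : Param M q → Param M q) := by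
  let f : Param M q →ₗ[ℝ] Param M q :=
    { toFun := restr S, map_add' := restr_add S, map_smul' := restr_smul S }
  refine AddMonoidHomClass.continuous_of_bound f 1 fun v => ?_
  rw [one_mul]
  refine norm_le_of_blocks fun b => ?_
  change ‖restr S v b‖ ≤ ‖v b‖
  by_cases h : b ∈ S
  · rw [restr_of_mem h]
  · rw [restr_of_notMem h, norm_zero]
    exact norm_nonneg _

lemma continuous_hierPenalty (lam : Block M → ℝ) :
    Continuous (hierPenalty lam : Param M q → ℝ) := by
  have h1 : ∀ i, Continuous fun v : Param M q => lam (Sum.inl i) * ‖restr (starGroup i) v‖ :=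
    fun i => continuous_const.mul (continuous_restr _).norm
  have h2 : ∀ p, Continuous fun v : Param M q => lam (Sum.inr p) * ‖v (Sum.inr p)‖ :=
    fun p => continuous_const.mul (PiLp.continuous_apply 2 _ (Sum.inr p)).norm
  exact (continuous_finsetSum _ fun i _ => h1 i).add (continuous_finsetSum _ fun p _ => h2 p)

/-- The groups of the penalty cover all blocks, so that it dominates the `ℓ₁/ℓ₂` norm. -/
lemma mul_norm12_le_hierPenalty {lam : Block M → ℝ} {l : ℝ} (hl : 0 ≤ l) (h : ∀ b, l ≤ lam b)
    (v : Param M q) : l * norm12 v ≤ hierPenalty lam v := by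
  unfold norm12 hierPenalty
  rw [Fintype.sum_sum_type, mul_add, Finset.mul_sum, Finset.mul_sum]
  refine add_le_add (Finset.sum_le_sum fun i _ => ?_) (Finset.sum_le_sum fun p _ => ?_)
  · have h1 : ‖v (Sum.inl i)‖ ≤ ‖restr (starGroup i) v‖ := by
      rw [← restr_of_mem (S := starGroup i) (Or.inl rfl) v]
      exact PiLp.norm_apply_le _ _
    exact mul_le_mul (h _) h1 (norm_nonneg _) (hl.trans (h _))
  · exact mul_le_mul_of_nonneg_right (h _) (norm_nonneg _)

lemma norm12_restr (S : Set (Block M)) [DecidablePred (· ∈ S)] (v : Param M q) :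
    norm12 (restr S v) = ∑ b, if b ∈ S then ‖v b‖ else 0 := by
  refine Finset.sum_congr rfl fun b _ => ?_
  split_ifs with h
  · rw [restr_of_mem h]
  · rw [restr_of_notMem h, norm_zero]

/-- Each block lies in at most three groups of the penalty: a main effect in its own group, an
interaction in the groups of its two tools and in the group that consists of it alone. -/
lemma hierPenalty_le_mul_norm12 {lam : Block M → ℝ} {u : ℝ} (hu : 0 ≤ u) (h : ∀ b, lam b ≤ u)
    (v : Param M q) : hierPenalty lam v ≤ 3 * u * norm12 v := by
  classical
  have h1 : ∑ i, lam (Sum.inl i) * ‖restr (starGroup i) v‖ ≤ 2 * u * norm12 v := by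
    calc ∑ i, lam (Sum.inl i) * ‖restr (starGroup i) v‖
        ≤ ∑ i, u * ∑ b, (if b ∈ starGroup i then ‖v b‖ else 0) := by
          refine Finset.sum_le_sum fun i _ => ?_
          rw [← norm12_restr]
          exact mul_le_mul (h _) (norm_le_norm12 _) (norm_nonneg _) hu
      _ = u * ∑ b, ∑ i, (if b ∈ starGroup i then ‖v b‖ else 0) := by
          rw [← Finset.mul_sum, Finset.sum_comm]
      _ ≤ u * ∑ b, 2 * ‖v b‖ := by
          gcongr with b
          rw [← Finset.sum_filter, Finset.sum_const, nsmul_eq_mul]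
          refine mul_le_mul_of_nonneg_right ?_ (norm_nonneg _)
          have : (Finset.univ.filter fun i => b ∈ starGroup i).card ≤ 2 := by
            rcases b with j | p
            · refine (Finset.card_le_card (t := {j}) fun i hi => ?_).trans (by simp)
              simpa [starGroup, eq_comm] using hi
            · refine (Finset.card_le_card (t := {p.1.1, p.1.2}) fun i hi => ?_).trans
                Finset.card_le_two
              have hi' : Sum.inr p ∈ starGroup i := by simpa using hi
              rcases hi' with hi' | ⟨p', hp, hi'⟩
              · cases hi'
              · cases hp
                simpa [eq_comm] using hi'
          exact_mod_cast this
      _ = 2 * u * norm12 v := by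
          rw [← Finset.mul_sum, norm12]; ring
  have h2 : ∑ p, lam (Sum.inr p) * ‖v (Sum.inr p)‖ ≤ u * norm12 v := by
    rw [norm12, Fintype.sum_sum_type, mul_add, Finset.mul_sum (f := fun p => ‖v (Sum.inr p)‖)]
    refine le_add_of_nonneg_of_le (by positivity) (Finset.sum_le_sum fun p _ => ?_)
    exact mul_le_mul_of_nonneg_right (h _) (norm_nonneg _)
  unfold hierPenalty
  linarith

lemma hierPenaltyOff_nonneg {lam : Block M → ℝ} (h : ∀ b, 0 ≤ lam b) (S : Set (Block M))
    (v : Param M q) : 0 ≤ hierPenaltyOff lam S v := by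
  refine add_nonneg (Finset.sum_nonneg fun i _ => ?_) (Finset.sum_nonneg fun p _ => ?_)
  · split_ifs
    · exact mul_nonneg (h _) (norm_nonneg _)
    · exact le_rfl
  · split_ifs
    · exact le_rfl
    · exact mul_nonneg (h _) (norm_nonneg _)

lemma restr_restr_compl {G S : Set (Block M)} (h : Disjoint G S) (v : Param M q) :
    restr G (restr Sᶜ v) = restr G v := by
  ext b k
  by_cases hb : b ∈ G
  · rw [restr_of_mem hb, restr_of_mem hb, restr_of_mem (Set.disjoint_left.1 h hb)]
  · rw [restr_of_notMem hb, restr_of_notMem hb]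

lemma hierPenaltyOff_restr_compl (lam : Block M → ℝ) (S : Set (Block M)) (v : Param M q) :
    hierPenaltyOff lam S (restr Sᶜ v) = hierPenaltyOff lam S v := by
  unfold hierPenaltyOff
  congr 1
  · refine Finset.sum_congr rfl fun i _ => ?_
    split_ifs with h
    · rw [restr_restr_compl h]
    · rfl
  · refine Finset.sum_congr rfl fun p _ => ?_
    split_ifs with h
    · rfl
    · rw [restr_of_mem (S := Sᶜ) h]

lemma hierPenaltyOff_eq_zero (lam : Block M → ℝ) {S : Set (Block M)} {v : Param M q}
    (hv : blockSupp v ⊆ S) : hierPenaltyOff lam S v = 0 := by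
  have h0 : restr Sᶜ v = 0 := by
    ext b k
    by_cases h : b ∈ S
    · rw [restr_of_notMem (by simpa using h)]; rfl
    · rw [restr_of_mem h, eq_zero_of_notMem hv h]; rfl
  have h1 : ∀ G : Set (Block M), restr G (0 : Param M q) = 0 := fun G => by
    simpa using restr_smul G 0 (0 : Param M q)
  rw [← hierPenaltyOff_restr_compl, h0]
  simp [hierPenaltyOff, h1]

/-- Under heredity the group of an inactive main effect contains no active interaction, so that
every inactive block lies in a group that is disjoint from the support. -/
lemma mul_norm12_le_hierPenaltyOff {lam : Block M → ℝ} {l : ℝ} (hl : 0 ≤ l) (h : ∀ b, l ≤ lam b)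
    {ϑ : Param M q} (hϑ : Heredity ϑ) {v : Param M q} (hv : blockSupp v ⊆ (blockSupp ϑ)ᶜ) :
    l * norm12 v ≤ hierPenaltyOff lam (blockSupp ϑ) v := by
  unfold norm12 hierPenaltyOff
  rw [Fintype.sum_sum_type, mul_add, Finset.mul_sum, Finset.mul_sum]
  refine add_le_add (Finset.sum_le_sum fun i _ => ?_) (Finset.sum_le_sum fun p _ => ?_)
  · by_cases hi : Sum.inl i ∈ blockSupp ϑ
    · rw [eq_zero_of_notMem hv (by simpa using hi), norm_zero, mul_zero]
      split_ifs
      · exact mul_nonneg (hl.trans (h _)) (norm_nonneg _)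
      · exact le_rfl
    · have hd : Disjoint (starGroup i) (blockSupp ϑ) := by
        rw [Set.disjoint_left]
        rintro _ (rfl | ⟨p, rfl, rfl | rfl⟩) hp
        · exact hi hp
        · exact hi (hϑ p hp).1
        · exact hi (hϑ p hp).2
      rw [if_pos hd]
      have h1 : ‖v (Sum.inl i)‖ ≤ ‖restr (starGroup i) v‖ := by
        rw [← restr_of_mem (S := starGroup i) (Or.inl rfl) v]
        exact PiLp.norm_apply_le _ _
      exact mul_le_mul (h _) h1 (norm_nonneg _) (hl.trans (h _))
  · split_ifs with hp
    · rw [eq_zero_of_notMem hv (by simpa using hp), norm_zero, mul_zero]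
    · exact mul_le_mul_of_nonneg_right (h _) (norm_nonneg _)

/-- Decomposability: at a point supported on `S`, moving off `S` costs at least `hierPenaltyOff`,
because deleting the blocks outside `S` can only decrease the norms of the groups that
meet `S`. -/
lemma hierPenalty_add_restr_add_off_le {lam : Block M → ℝ} (h : ∀ b, 0 ≤ lam b)
    {S : Set (Block M)} {v : Param M q} (hv : blockSupp v ⊆ S) (x : Param M q) :
    hierPenalty lam (v + restr S x) + hierPenaltyOff lam S x ≤ hierPenalty lam (v + x) := by
  have hb : ∀ b, ‖(v + restr S x) b‖ ≤ ‖(v + x) b‖ := fun b => by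
    by_cases hb : b ∈ S
    · simp [restr_of_mem hb]
    · simp [restr_of_notMem hb, eq_zero_of_notMem hv hb]
  unfold hierPenalty hierPenaltyOff
  rw [add_add_add_comm, ← Finset.sum_add_distrib, ← Finset.sum_add_distrib]
  refine add_le_add (Finset.sum_le_sum fun i _ => ?_) (Finset.sum_le_sum fun p _ => ?_)
  · split_ifs with hd
    · have h0 : restr (starGroup i) (v + restr S x) = 0 := by
        ext b k
        by_cases hbi : b ∈ starGroup i
        · have hbS := Set.disjoint_left.1 hd hbi
          simp [restr_of_mem hbi, restr_of_notMem hbS, eq_zero_of_notMem hv hbS]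
        · simp [restr_of_notMem hbi]
      have h1 : restr (starGroup i) (v + x) = restr (starGroup i) x := by
        ext b k
        by_cases hbi : b ∈ starGroup i
        · have hbS := Set.disjoint_left.1 hd hbi
          simp [restr_of_mem hbi, eq_zero_of_notMem hv hbS]
        · simp [restr_of_notMem hbi]
      rw [h0, h1, norm_zero, mul_zero, zero_add]
    · rw [add_zero]
      refine mul_le_mul_of_nonneg_left (norm_le_of_blocks fun b => ?_) (h _)
      by_cases hbi : b ∈ starGroup i
      · rw [restr_of_mem hbi, restr_of_mem hbi]
        exact hb b
      · rw [restr_of_notMem hbi, restr_of_notMem hbi]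
  · split_ifs with hp
    · rw [add_zero]
      exact mul_le_mul_of_nonneg_left (hb _) (h _)
    · simp [restr_of_notMem hp, eq_zero_of_notMem hv hp]

/-! ### Quadratic losses, their gradients and Hessians -/

section Quadratic

variable {E : Type*} [NormedAddCommGroup E] [InnerProductSpace ℝ E]

/-- The second moment operator `T⁻¹ ∑_t z_t ⊗ z_t` of the features. -/
noncomputable def gram (T : ℕ) (z : ℕ → E) : E →L[ℝ] E :=
  (T : ℝ)⁻¹ • ∑ t ∈ Finset.range T, InnerProductSpace.rankOne ℝ (z t) (z t)

/-- The score `T⁻¹ ∑_t ξ_t z_t` at `ϑ`, the negative gradient of the empirical loss. -/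
noncomputable def score (T : ℕ) (y : ℕ → ℝ) (z : ℕ → E) (ϑ : E) : E :=
  (T : ℝ)⁻¹ • ∑ t ∈ Finset.range T, (y t - inner ℝ ϑ (z t)) • z t

lemma inner_gram (T : ℕ) (z : ℕ → E) (u v : E) :
    inner ℝ (gram T z u) v =
      (T : ℝ)⁻¹ * ∑ t ∈ Finset.range T, inner ℝ (z t) u * inner ℝ (z t) v := by
  simp [gram, inner_smul_left, sum_inner]

lemma inner_gram_comm (T : ℕ) (z : ℕ → E) (u v : E) :
    inner ℝ (gram T z u) v = inner ℝ u (gram T z v) := by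
  rw [real_inner_comm (gram T z v) u, inner_gram, inner_gram]
  simp only [mul_comm]

lemma inner_gram_self_nonneg (T : ℕ) (z : ℕ → E) (u : E) :
    0 ≤ inner ℝ (gram T z u) u := by
  rw [inner_gram]
  exact mul_nonneg (by positivity) (Finset.sum_nonneg fun _ _ => mul_self_nonneg _)

lemma integrable_gram_of_bounded {Ω : Type*} {mΩ : MeasurableSpace Ω} {P : Measure Ω}
    [IsFiniteMeasure P] {T : ℕ} {z : ℕ → Ω → E} {c : ℝ}
    (hm : ∀ t < T, AEStronglyMeasurable (z t) P) (hb : ∀ t < T, ∀ᵐ ω ∂P, ‖z t ω‖ ≤ c) :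
    Integrable (fun ω => gram T fun t => z t ω) P := by
  suffices h' : ∀ t ∈ Finset.range T, Integrable (fun ω =>
      InnerProductSpace.rankOne ℝ (z t ω) (z t ω)) P from
    (integrable_finsetSum _ h').fun_smul _
  intro t ht
  rw [Finset.mem_range] at ht
  have hc : Continuous fun x : E => InnerProductSpace.rankOne ℝ x x :=
    (InnerProductSpace.rankOne ℝ).continuous.clm_apply continuous_id
  refine Integrable.of_bound (hc.comp_aestronglyMeasurable (hm t ht)) (c * c) ?_
  filter_upwards [hb t ht] with ω hω
  rw [InnerProductSpace.norm_rankOne]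
  exact mul_le_mul hω hω (norm_nonneg _) ((norm_nonneg _).trans hω)

variable [CompleteSpace E]

lemma hasGradientAt_of_quadratic {f : E → ℝ} {x₀ b : E} {Q : E →L[ℝ] E}
    (hQ : ∀ u v, inner ℝ (Q u) v = inner ℝ u (Q v))
    (hf : ∀ Δ, f (x₀ + Δ) = f x₀ + inner ℝ b Δ + 1 / 2 * inner ℝ (Q Δ) Δ) (x : E) :
    HasGradientAt f (b + Q (x - x₀)) x := by
  have hf' : f = fun x => f x₀ + inner ℝ b (x - x₀) + 1 / 2 * inner ℝ (Q (x - x₀)) (x - x₀) := by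
    funext x
    rw [← hf, add_sub_cancel]
  rw [hasGradientAt_iff_hasFDerivAt, hf']
  have h1 : HasFDerivAt (fun x => x - x₀) (ContinuousLinearMap.id ℝ E) x :=
    (hasFDerivAt_id x).sub_const x₀
  have h2 : HasFDerivAt (fun x => Q (x - x₀)) (Q.comp (ContinuousLinearMap.id ℝ E)) x :=
    Q.hasFDerivAt.comp x h1
  have h3 := (((hasFDerivAt_const b x).inner ℝ h1).const_add (f x₀)).add
    ((h2.inner ℝ h1).const_mul (1 / 2))
  refine h3.congr_fderiv ?_
  ext v
  simp only [ContinuousLinearMap.comp_id, add_apply, smul_apply,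
    ContinuousLinearMap.comp_apply, ContinuousLinearMap.prod_apply,
    zero_apply, ContinuousLinearMap.id_apply, fderivInnerCLM_apply, hQ v,
    InnerProductSpace.toDual_apply_apply, inner_add_left, inner_zero_left, smul_eq_mul,
    real_inner_comm (Q (x - x₀)) v]
  ring

lemma gradient_of_quadratic {f : E → ℝ} {x₀ b : E} {Q : E →L[ℝ] E}
    (hQ : ∀ u v, inner ℝ (Q u) v = inner ℝ u (Q v))
    (hf : ∀ Δ, f (x₀ + Δ) = f x₀ + inner ℝ b Δ + 1 / 2 * inner ℝ (Q Δ) Δ) :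
    gradient f x₀ = b := by
  simpa using (hasGradientAt_of_quadratic hQ hf x₀).gradient

lemma fderiv_gradient_of_quadratic {f : E → ℝ} {x₀ b : E} {Q : E →L[ℝ] E}
    (hQ : ∀ u v, inner ℝ (Q u) v = inner ℝ u (Q v))
    (hf : ∀ Δ, f (x₀ + Δ) = f x₀ + inner ℝ b Δ + 1 / 2 * inner ℝ (Q Δ) Δ) :
    fderiv ℝ (gradient f) x₀ = Q := by
  have h : gradient f = fun x => b + Q (x - x₀) :=
    funext fun x => (hasGradientAt_of_quadratic hQ hf x).gradient
  have h1 : HasFDerivAt (fun x => Q (x - x₀)) (Q.comp (ContinuousLinearMap.id ℝ E)) x₀ :=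
    Q.hasFDerivAt.comp x₀ ((hasFDerivAt_id x₀).sub_const x₀)
  rw [h, (h1.const_add b).fderiv, ContinuousLinearMap.comp_id]

end Quadratic

lemma empLoss_add (T : ℕ) (y : ℕ → ℝ) (z : ℕ → Param M q) (ϑ Δ : Param M q) :
    empLoss T y z (ϑ + Δ) = empLoss T y z ϑ + inner ℝ (-score T y z ϑ) Δ +
      1 / 2 * inner ℝ (gram T z Δ) Δ := by
  have h1 : inner ℝ (score T y z ϑ) Δ =
      (T : ℝ)⁻¹ * ∑ t ∈ Finset.range T, (y t - inner ℝ ϑ (z t)) * inner ℝ (z t) Δ := by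
    simp [score, inner_smul_left, sum_inner]
  rw [inner_neg_left, h1, inner_gram]
  unfold empLoss
  rw [one_div (2 * (T : ℝ)), mul_inv, Finset.mul_sum, Finset.mul_sum, Finset.mul_sum,
    Finset.mul_sum, Finset.mul_sum, ← Finset.sum_neg_distrib, ← Finset.sum_add_distrib,
    ← Finset.sum_add_distrib]
  refine Finset.sum_congr rfl fun t _ => ?_
  rw [inner_add_left, real_inner_comm (z t) Δ]
  ring

lemma score_add (T : ℕ) (y : ℕ → ℝ) (z : ℕ → Param M q) (ϑ Δ : Param M q) :
    score T y z (ϑ + Δ) = score T y z ϑ - gram T z Δ := by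
  simp only [score, gram, smul_apply, sum_apply,
    InnerProductSpace.rankOne_apply, ← smul_sub, ← Finset.sum_sub_distrib, ← sub_smul,
    inner_add_left]
  congr 1
  refine Finset.sum_congr rfl fun t _ => ?_
  rw [real_inner_comm (z t) Δ, sub_add_eq_sub_sub]

lemma hess_empLoss (T : ℕ) (y : ℕ → ℝ) (z : ℕ → Param M q) (ϑ : Param M q) :
    hess (empLoss T y z) ϑ = gram T z :=
  fderiv_gradient_of_quadratic (inner_gram_comm T z) (empLoss_add T y z ϑ)

lemma empLoss_nonneg (T : ℕ) (y : ℕ → ℝ) (z : ℕ → Param M q) (ϑ : Param M q) :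
    0 ≤ empLoss T y z ϑ :=
  mul_nonneg (by positivity) (Finset.sum_nonneg fun _ _ => sq_nonneg _)

lemma continuous_empLoss (T : ℕ) (y : ℕ → ℝ) (z : ℕ → Param M q) :
    Continuous (empLoss T y z) := by
  refine continuous_const.mul (continuous_finsetSum _ fun t _ => ?_)
  exact (continuous_const.sub (continuous_id.inner continuous_const)).pow 2

section Population

variable {Ω : Type*} [mΩ : MeasurableSpace Ω] {P : Measure Ω}
  {ℱ : Filtration ℕ mΩ} {T : ℕ} {y : ℕ → Ω → ℝ} {z : ℕ → Ω → Param M q} {ϑ : Param M q} {σ : ℝ}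

lemma IsSynergyModel.aestronglyMeasurable_feature (h : IsSynergyModel P ℱ T y z ϑ σ) {t : ℕ}
    (ht : t < T) : AEStronglyMeasurable (z t) P :=
  ((h.measurable_feature t ht).mono (ℱ.le t)).aestronglyMeasurable

lemma IsSynergyModel.norm_feature_le (h : IsSynergyModel P ℱ T y z ϑ σ) {t : ℕ} (ht : t < T) :
    ∀ᵐ ω ∂P, ‖z t ω‖ ≤ Fintype.card (Block M) := by
  filter_upwards [h.bounded_feature t ht] with ω hω
  calc ‖z t ω‖ ≤ norm12 (z t ω) := norm_le_norm12 _
    _ ≤ ∑ _b : Block M, (1 : ℝ) := Finset.sum_le_sum fun b _ => hω b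
    _ = _ := by simp

lemma IsSynergyModel.integrable_noise_pow (h : IsSynergyModel P ℱ T y z ϑ σ) {t : ℕ} (ht : t < T)
    (n : ℕ) : Integrable (fun ω => (y t ω - inner ℝ ϑ (z t ω)) ^ n) P :=
  ProbabilityTheory.integrable_pow_of_integrable_exp_mul one_ne_zero
    (h.noise_integrable t ht 1) (h.noise_integrable t ht (-1)) n

lemma IsSynergyModel.integrable_empLoss (h : IsSynergyModel P ℱ T y z ϑ σ) :
    Integrable (fun ω => empLoss T (fun t => y t ω) (fun t => z t ω) ϑ) P := by
  refine Integrable.const_mul (integrable_finsetSum _ fun t ht => ?_) _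
  exact h.integrable_noise_pow (Finset.mem_range.1 ht) 2

lemma IsSynergyModel.integrable_score (h : IsSynergyModel P ℱ T y z ϑ σ) :
    Integrable (fun ω => score T (fun t => y t ω) (fun t => z t ω) ϑ) P := by
  suffices h' : ∀ t ∈ Finset.range T, Integrable (fun ω =>
      (y t ω - inner ℝ ϑ (z t ω)) • z t ω) P from
    (integrable_finsetSum _ h').fun_smul _
  intro t ht
  rw [Finset.mem_range] at ht
  have h1 : Integrable (fun ω => y t ω - inner ℝ ϑ (z t ω)) P := by
    simpa using h.integrable_noise_pow ht 1
  exact h1.smul_bdd _ (h.aestronglyMeasurable_feature ht) (h.norm_feature_le ht)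

variable [IsProbabilityMeasure P]

lemma IsSynergyModel.integrable_gram (h : IsSynergyModel P ℱ T y z ϑ σ) :
    Integrable (fun ω => gram T fun t => z t ω) P :=
  integrable_gram_of_bounded (fun _ ht => h.aestronglyMeasurable_feature ht)
    fun _ ht => h.norm_feature_le ht

lemma IsSynergyModel.inner_integral_gram (h : IsSynergyModel P ℱ T y z ϑ σ) (u v : Param M q) :
    inner ℝ ((∫ ω, gram T (fun t => z t ω) ∂P) u) v =
      ∫ ω, inner ℝ (gram T (fun t => z t ω) u) v ∂P := by
  rw [ContinuousLinearMap.integral_apply h.integrable_gram, real_inner_comm,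
    ← integral_inner (h.integrable_gram.apply_continuousLinearMap u)]
  simp only [real_inner_comm]

lemma IsSynergyModel.popLoss_add (h : IsSynergyModel P ℱ T y z ϑ σ) (Δ : Param M q) :
    popLoss P T y z (ϑ + Δ) = popLoss P T y z ϑ +
      inner ℝ (-∫ ω, score T (fun t => y t ω) (fun t => z t ω) ϑ ∂P) Δ +
      1 / 2 * inner ℝ ((∫ ω, gram T (fun t => z t ω) ∂P) Δ) Δ := by
  have hs : Integrable
      (fun ω => inner ℝ Δ (-score T (fun t => y t ω) (fun t => z t ω) ϑ)) P :=
    h.integrable_score.neg.const_inner Δ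
  have hg : Integrable (fun ω => inner ℝ (gram T (fun t => z t ω) Δ) Δ) P :=
    (h.integrable_gram.apply_continuousLinearMap Δ).inner_const Δ
  have hi : inner ℝ (-∫ ω, score T (fun t => y t ω) (fun t => z t ω) ϑ ∂P) Δ =
      ∫ ω, inner ℝ Δ (-score T (fun t => y t ω) (fun t => z t ω) ϑ) ∂P := by
    rw [← integral_neg, real_inner_comm]
    exact (integral_inner h.integrable_score.neg Δ).symm
  rw [h.inner_integral_gram, hi, ← integral_const_mul]
  unfold popLoss
  rw [← integral_add h.integrable_empLoss hs,
    ← integral_add (h.integrable_empLoss.fun_add hs) (hg.const_mul _)]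
  refine integral_congr_ae (.of_forall fun ω => ?_)
  simp only
  rw [empLoss_add, real_inner_comm]

lemma IsSynergyModel.inner_integral_gram_comm (h : IsSynergyModel P ℱ T y z ϑ σ)
    (u v : Param M q) : inner ℝ ((∫ ω, gram T (fun t => z t ω) ∂P) u) v =
      inner ℝ u ((∫ ω, gram T (fun t => z t ω) ∂P) v) := by
  rw [← real_inner_comm u, h.inner_integral_gram, h.inner_integral_gram]
  refine integral_congr_ae (.of_forall fun ω => ?_)
  simp only
  rw [inner_gram_comm, real_inner_comm]

/-- The population loss is quadratic, so that its second order expansion is exact. -/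
lemma IsSynergyModel.popLoss_eq_taylor (h : IsSynergyModel P ℱ T y z ϑ σ) (Δ : Param M q) :
    popLoss P T y z (ϑ + Δ) = popLoss P T y z ϑ + inner ℝ (gradient (popLoss P T y z) ϑ) Δ +
      1 / 2 * inner ℝ (hess (popLoss P T y z) ϑ Δ) Δ := by
  rw [hess, gradient_of_quadratic h.inner_integral_gram_comm h.popLoss_add,
    fderiv_gradient_of_quadratic h.inner_integral_gram_comm h.popLoss_add]
  exact h.popLoss_add Δ

end Population

/-! ### The estimator restricted to the true support -/

lemma exists_isMinOn_restricted (T : ℕ) (y : ℕ → ℝ) (z : ℕ → Param M q) {lam : Block M → ℝ}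
    {lo : ℝ} (hlo : 0 < lo) (hlam : ∀ b, lo ≤ lam b) (S : Set (Block M)) :
    ∃ v : Param M q, blockSupp v ⊆ S ∧
      IsMinOn (fun x => empLoss T y z x + hierPenalty lam x) {x | blockSupp x ⊆ S} v := by
  have hclosed : IsClosed {x : Param M q | blockSupp x ⊆ S} := by
    have : {x : Param M q | blockSupp x ⊆ S} = {x | restr S x = x} := by
      ext x
      exact ⟨restr_eq_self, fun h : restr S x = x => h ▸ blockSupp_restr_subset S x⟩
    rw [this]
    exact isClosed_eq (continuous_restr S) continuous_id
  have hcont : Continuous fun x => empLoss T y z x + hierPenalty lam x :=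
    (continuous_empLoss T y z).add (continuous_hierPenalty lam)
  have h0 : (0 : Param M q) ∈ {x : Param M q | blockSupp x ⊆ S} := by simp [blockSupp]
  obtain ⟨v, hv, hmin⟩ := hcont.continuousOn.exists_isMinOn' hclosed h0 (by
    refine Filter.Eventually.filter_mono inf_le_left ?_
    filter_upwards [(tendsto_norm_cocompact_atTop (E := Param M q)).eventually_ge_atTop
      ((empLoss T y z 0 + hierPenalty lam 0) / lo)] with x hx
    rw [div_le_iff₀ hlo] at hx
    have h1 := mul_norm12_le_hierPenalty hlo.le hlam x
    have h2 := mul_le_mul_of_nonneg_left (norm_le_norm12 x) hlo.le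
    have h3 := empLoss_nonneg T y z x
    linarith)
  exact ⟨v, hv, hmin⟩

section Optimality

variable {T : ℕ} {y : ℕ → ℝ} {z : ℕ → Param M q} {lam : Block M → ℝ} {S : Set (Block M)}
  {v : Param M q}

/-- First order optimality of the restricted estimator: the score at `v` is a subgradient of the
penalty along `S`. -/
lemma inner_score_le_sub (hlam : ∀ b, 0 ≤ lam b) (hv : blockSupp v ⊆ S)
    (hmin : IsMinOn (fun x => empLoss T y z x + hierPenalty lam x) {x | blockSupp x ⊆ S} v)
    {x : Param M q} (hx : blockSupp x ⊆ S) :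
    inner ℝ (score T y z v) x ≤ hierPenalty lam (v + x) - hierPenalty lam v := by
  set d := hierPenalty lam (v + x) - hierPenalty lam v - inner ℝ (score T y z v) x with hd
  set Q := inner ℝ (gram T z x) x
  -- along the segment towards `v + x` the objective grows at most by `ε d + ε² Q / 2`
  have key : ∀ ε : ℝ, 0 < ε → ε ≤ 1 → 0 ≤ d + ε / 2 * Q := by
    intro ε hε hε1
    have h1 : empLoss T y z v + hierPenalty lam v
        ≤ empLoss T y z (v + ε • x) + hierPenalty lam (v + ε • x) :=
      hmin (blockSupp_add_subset hv (blockSupp_smul_subset ε hx))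
    have h2 : hierPenalty lam (v + ε • x)
        ≤ (1 - ε) * hierPenalty lam v + ε * hierPenalty lam (v + x) := by
      have : v + ε • x = (1 - ε) • v + ε • (v + x) := by module
      rw [this, ← hierPenalty_smul lam (sub_nonneg.2 hε1), ← hierPenalty_smul lam hε.le]
      exact hierPenalty_add_le hlam _ _
    rw [empLoss_add, map_smul, inner_smul_right, inner_smul_left, inner_smul_right,
      inner_neg_left] at h1
    simp only [conj_trivial] at h1
    have h3 : 0 ≤ ε * (d + ε / 2 * Q) := by
      rw [hd]; nlinarith
    exact nonneg_of_mul_nonneg_right h3 hε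
  suffices 0 ≤ d by linarith
  by_contra! hneg
  have hQ := key 1 one_pos le_rfl
  have hQ0 : 0 < Q := by linarith
  have hε : 0 < -d / Q := div_pos (neg_pos.2 hneg) hQ0
  have := key (min 1 (-d / Q)) (lt_min one_pos hε) (min_le_left _ _)
  have h4 : min 1 (-d / Q) * Q ≤ -d := by
    calc _ ≤ -d / Q * Q := mul_le_mul_of_nonneg_right (min_le_right _ _) hQ0.le
      _ = -d := div_mul_cancel₀ _ hQ0.ne'
  linarith

lemma inner_score_le_hierPenalty (hlam : ∀ b, 0 ≤ lam b) (hv : blockSupp v ⊆ S)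
    (hmin : IsMinOn (fun x => empLoss T y z x + hierPenalty lam x) {x | blockSupp x ⊆ S} v)
    {x : Param M q} (hx : blockSupp x ⊆ S) :
    inner ℝ (score T y z v) x ≤ hierPenalty lam x := by
  have h1 := inner_score_le_sub hlam hv hmin hx
  have h2 := hierPenalty_add_le hlam v x
  linarith

lemma norm_score_le (hlam : ∀ b, 0 ≤ lam b) {hi : ℝ} (hhi : 0 ≤ hi) (hlamhi : ∀ b, lam b ≤ hi)
    (hv : blockSupp v ⊆ S)
    (hmin : IsMinOn (fun x => empLoss T y z x + hierPenalty lam x) {x | blockSupp x ⊆ S} v)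
    {b : Block M} (hb : b ∈ S) : ‖score T y z v b‖ ≤ 3 * hi := by
  have h1 : inner ℝ (score T y z v) (restr {b} (score T y z v)) ≤ _ :=
    inner_score_le_hierPenalty hlam hv hmin
      ((blockSupp_restr_subset {b} _).trans (Set.singleton_subset_iff.2 hb))
  have h2 := hierPenalty_le_mul_norm12 hhi hlamhi (restr {b} (score T y z v))
  rw [norm12_restr_singleton] at h2
  rw [inner_restr_singleton] at h1
  by_contra! h
  nlinarith [norm_nonneg (score T y z v b)]

/-- If the score of the restricted estimator is strictly dominated by the penalty off `S`, then
the restricted estimator beats every other point by a multiple of the penalty off `S`. -/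
lemma objective_add_le (hlam : ∀ b, 0 ≤ lam b) (hv : blockSupp v ⊆ S)
    (hmin : IsMinOn (fun x => empLoss T y z x + hierPenalty lam x) {x | blockSupp x ⊆ S} v)
    {κ : ℝ} (hoff : ∀ x : Param M q, blockSupp x ⊆ Sᶜ →
      inner ℝ (score T y z v) x ≤ (1 - κ) * hierPenaltyOff lam S x) (x : Param M q) :
    empLoss T y z v + hierPenalty lam v + κ * hierPenaltyOff lam S x
      ≤ empLoss T y z (v + x) + hierPenalty lam (v + x) := by
  have h1 := inner_score_le_sub hlam hv hmin (blockSupp_restr_subset S x)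
  have h2 := hoff _ (blockSupp_restr_subset Sᶜ x)
  rw [hierPenaltyOff_restr_compl] at h2
  have h3 := hierPenalty_add_restr_add_off_le hlam hv x
  have h4 : inner ℝ (score T y z v) x = inner ℝ (score T y z v) (restr S x) +
      inner ℝ (score T y z v) (restr Sᶜ x) := by
    rw [← inner_add_right, restr_add_restr_compl]
  rw [empLoss_add, inner_neg_left, h4]
  have h5 := inner_gram_self_nonneg T z x
  linarith

end Optimality

/-! ### Deterministic recovery -/

/-- On the support, restricted strong convexity bounds the curvature of a quadratic from below. -/
lemma HierRSC.mul_sq_norm_le {L : Param M q → ℝ} {ϑ : Param M q} {lam : Block M → ℝ} {μ : ℝ}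
    (hlam : ∀ b, 0 ≤ lam b) (h : HierRSC L ϑ lam μ)
    (hL : ∀ Δ, L (ϑ + Δ) = L ϑ + inner ℝ (gradient L ϑ) Δ + 1 / 2 * inner ℝ (hess L ϑ Δ) Δ)
    {Δ : Param M q} (hΔ : blockSupp Δ ⊆ blockSupp ϑ) :
    μ * ‖Δ‖ ^ 2 ≤ inner ℝ (hess L ϑ Δ) Δ := by
  have hc : Δ ∈ hierCone lam (blockSupp ϑ) := by
    change hierPenaltyOff lam (blockSupp ϑ) Δ ≤ 3 * hierPenalty lam (restr (blockSupp ϑ) Δ)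
    rw [hierPenaltyOff_eq_zero lam hΔ]
    exact mul_nonneg (by norm_num) (hierPenalty_nonneg hlam _)
  have h1 := h Δ hc
  rw [hL] at h1
  linarith

section Witness

variable {T : ℕ} {y : ℕ → ℝ} {z : ℕ → Param M q} {lam : Block M → ℝ} {S : Set (Block M)}
  {ϑ v : Param M q} {H : Param M q →L[ℝ] Param M q} {lo hi ε η D : ℝ}

/-- The error of the restricted estimator solves the normal equation
`H (v - ϑ) = score(ϑ) - score(v) - (Ĥ - H) (v - ϑ)`. -/
lemma inner_hess_eq (x : Param M q) :
    inner ℝ (H (v - ϑ)) x = inner ℝ (score T y z ϑ) x - inner ℝ (score T y z v) x -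
      inner ℝ (gram T z (v - ϑ) - H (v - ϑ)) x := by
  have h := score_add T y z ϑ (v - ϑ)
  rw [add_sub_cancel] at h
  rw [h, ← inner_sub_left, ← inner_sub_left]
  congr 1
  abel

lemma normInf2_sub_le (hlam : ∀ b, 0 ≤ lam b) (hhi : 0 ≤ hi) (hlamhi : ∀ b, lam b ≤ hi)
    (hlo : 0 ≤ lo) (hε : 0 ≤ ε)
    (hv : blockSupp v ⊆ S) (hϑ : blockSupp ϑ ⊆ S)
    (hmin : IsMinOn (fun x => empLoss T y z x + hierPenalty lam x) {x | blockSupp x ⊆ S} v)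
    (hg : ∀ b, ‖score T y z ϑ b‖ ≤ ε * lo) (hD : 0 ≤ D) (hη : 0 ≤ η) (hηD : D * η ≤ 1 / 2)
    (hinv : InvBound H S D) (hclose : HessClose (gram T z) H S η) :
    normInf2 (v - ϑ) ≤ 2 * D * (3 * hi + ε * lo) := by
  have hΔ := blockSupp_sub_subset hv hϑ
  set Δ := v - ϑ
  have h1 : normInf2 (restr S (H Δ)) ≤ 3 * hi + ε * lo + η * normInf2 Δ := by
    have h0 := normInf2_nonneg Δ
    refine normInf2_le (by positivity) fun b => ?_
    by_cases hb : b ∈ S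
    · rw [restr_of_mem hb]
      have h2 : H Δ = score T y z ϑ - score T y z v - (gram T z Δ - H Δ) :=
        ext_inner_right ℝ fun x => by
          rw [inner_hess_eq (T := T) (y := y) (z := z), ← inner_sub_left, ← inner_sub_left]
      have h3 : ‖H Δ b‖ ≤ ‖score T y z ϑ b‖ + ‖score T y z v b‖ + ‖(gram T z Δ - H Δ) b‖ := by
        conv_lhs => rw [h2]
        exact (norm_sub_le _ _).trans (add_le_add_left (norm_sub_le _ _) _)
      have h4 := norm_score_le hlam hhi hlamhi hv hmin hb
      have h5 := (norm_apply_le_normInf2 _ b).trans (hclose Δ hΔ)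
      linarith [hg b]
    · rw [restr_of_notMem hb, norm_zero]
      positivity
  have h2 := hinv Δ hΔ
  have h3 : normInf2 Δ ≤ D * (3 * hi + ε * lo) + D * η * normInf2 Δ := by
    calc _ ≤ _ := h2
      _ ≤ D * (3 * hi + ε * lo + η * normInf2 Δ) := mul_le_mul_of_nonneg_left h1 hD
      _ = _ := by ring
  have h4 := mul_le_mul_of_nonneg_right hηD (normInf2_nonneg Δ)
  linarith

lemma mul_norm_sub_le (hlam : ∀ b, 0 ≤ lam b) (hhi : 0 ≤ hi) (hlamhi : ∀ b, lam b ≤ hi)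
    (hlo : 0 ≤ lo) (hε : 0 ≤ ε) {μ : ℝ}
    (hv : blockSupp v ⊆ S) (hϑ : blockSupp ϑ ⊆ S)
    (hmin : IsMinOn (fun x => empLoss T y z x + hierPenalty lam x) {x | blockSupp x ⊆ S} v)
    (hg : ∀ b, ‖score T y z ϑ b‖ ≤ ε * lo)
    (hE : ∀ b, ‖(gram T z (v - ϑ) - H (v - ϑ)) b‖ ≤ ε * lo)
    (hμ : μ * ‖v - ϑ‖ ^ 2 ≤ inner ℝ (H (v - ϑ)) (v - ϑ)) :
    μ * ‖v - ϑ‖ ≤ 2 * (3 * hi + ε * lo) * √(S.ncard : ℝ) := by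
  have hΔ := blockSupp_sub_subset hv hϑ
  rw [inner_hess_eq (T := T) (y := y) (z := z)] at hμ
  set Δ := v - ϑ
  have h1 := inner_score_le_hierPenalty hlam hv hmin (blockSupp_neg_subset hΔ)
  have h2 := hierPenalty_le_mul_norm12 hhi hlamhi Δ
  rw [hierPenalty_neg, inner_neg_right] at h1
  have h3 := inner_le_mul_norm12 hg Δ
  have h4 := inner_le_mul_norm12 hE (-Δ)
  rw [norm12_neg, inner_neg_right] at h4
  have h5 := norm12_le_sqrt_ncard_mul hΔ
  have h6 := norm12_nonneg Δ
  have h7 : μ * ‖Δ‖ ^ 2 ≤ 2 * (3 * hi + ε * lo) * √(S.ncard : ℝ) * ‖Δ‖ := by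
    calc μ * ‖Δ‖ ^ 2 ≤ (3 * hi + 2 * (ε * lo)) * norm12 Δ := by linarith
      _ ≤ 2 * (3 * hi + ε * lo) * norm12 Δ := mul_le_mul_of_nonneg_right (by linarith) h6
      _ ≤ 2 * (3 * hi + ε * lo) * (√(S.ncard : ℝ) * ‖Δ‖) :=
        mul_le_mul_of_nonneg_left h5 (by positivity)
      _ = _ := by ring
  rcases (norm_nonneg Δ).eq_or_lt with h0 | h0
  · rw [← h0, mul_zero]
    positivity
  · refine le_of_mul_le_mul_right ?_ h0
    linarith

/-- Strict dual feasibility: the incoherence margin absorbs the noise and the fluctuation of the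
Hessian, each of which is at most `α / 8` times the penalty. -/
lemma inner_score_le_off {α : ℝ} (hα : 0 < α) (hlo : 0 ≤ lo)
    (hlam : ∀ b, lo ≤ lam b) (hher : Heredity ϑ) (hv : blockSupp v ⊆ blockSupp ϑ)
    (hmin : IsMinOn (fun x => empLoss T y z x + hierPenalty lam x)
      {x | blockSupp x ⊆ blockSupp ϑ} v)
    (hg : ∀ b, ‖score T y z ϑ b‖ ≤ α / 8 * lo)
    (hE : ∀ b, ‖(gram T z (v - ϑ) - H (v - ϑ)) b‖ ≤ α / 8 * lo)
    (hinc : HierIncoherent H (blockSupp ϑ) lam α)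
    {x : Param M q} (hx : blockSupp x ⊆ (blockSupp ϑ)ᶜ) :
    inner ℝ (score T y z v) x ≤ (1 - α / 2) * hierPenaltyOff lam (blockSupp ϑ) x := by
  have hlam0 : ∀ b, 0 ≤ lam b := fun b => hlo.trans (hlam b)
  have hΔ := blockSupp_sub_subset hv subset_rfl
  have hH : ∀ x, inner ℝ (H (v - ϑ)) x = _ := inner_hess_eq (T := T) (y := y) (z := z)
  set Δ := v - ϑ
  set c : ℝ := 1 + α / 4 with hc
  have hc0 : 0 < c := by positivity
  -- the negative error, scaled into the dual unit ball
  set a : Param M q := (-c⁻¹) • Δ with ha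
  have hHa : ∀ x, inner ℝ (H a) x = c⁻¹ * -inner ℝ (H Δ) x := fun x => by
    rw [ha, map_smul, inner_smul_left]
    simp
  have hbound : ∀ w : Param M q, blockSupp w ⊆ blockSupp ϑ →
      inner ℝ (H a) w ≤ hierPenalty lam w := fun w hw => by
    have h1 := inner_score_le_hierPenalty hlam0 hv hmin hw
    have h2 := mul_norm12_le_hierPenalty hlo hlam w
    have h3 := inner_le_mul_norm12 hg (-w)
    rw [norm12_neg, inner_neg_right] at h3
    have h4 := inner_le_mul_norm12 hE w
    rw [hHa, inv_mul_le_iff₀ hc0, hH, hc]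
    nlinarith
  have h1 := hinc a (blockSupp_smul_subset _ hΔ) hbound x hx
  rw [hHa, inv_mul_le_iff₀ hc0, hH, hc] at h1
  have h2 := mul_norm12_le_hierPenaltyOff hlo hlam hher hx
  have h3 := inner_le_mul_norm12 hg x
  have h4 := inner_le_mul_norm12 hE (-x)
  rw [norm12_neg, inner_neg_right] at h4
  have h5 := hierPenaltyOff_nonneg hlam0 (blockSupp ϑ) x
  nlinarith [mul_nonneg (mul_nonneg hα.le hα.le) h5]

end Witness

/-- Primal-dual witness: on the event that the score at `ϑ` is small and the Hessian is stable,
the minimizers of the penalized loss exist, are supported on the support of `ϑ`, and are close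
to `ϑ` both blockwise and in the Euclidean norm. -/
lemma recovery_of_small_score {T : ℕ} {y : ℕ → ℝ} {z : ℕ → Param M q} {lam : Block M → ℝ}
    {ϑ : Param M q} {H : Param M q →L[ℝ] Param M q} {lo hi η D α μ : ℝ}
    (hα : 0 < α) (hlo : 0 < lo) (hlam : ∀ b, lo ≤ lam b) (hhi : 0 ≤ hi)
    (hlamhi : ∀ b, lam b ≤ hi) (hD : 0 ≤ D) (hη : 0 ≤ η) (hηD : D * η ≤ 1 / 2)
    (hηlo : η * (2 * D * (3 * hi + α / 8 * lo)) ≤ α / 8 * lo)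
    (hher : Heredity ϑ) (hg : ∀ b, ‖score T y z ϑ b‖ ≤ α / 8 * lo)
    (hinv : InvBound H (blockSupp ϑ) D) (hclose : HessClose (gram T z) H (blockSupp ϑ) η)
    (hinc : HierIncoherent H (blockSupp ϑ) lam α)
    (hμ : ∀ Δ : Param M q, blockSupp Δ ⊆ blockSupp ϑ → μ * ‖Δ‖ ^ 2 ≤ inner ℝ (H Δ) Δ) :
    (∃ v, IsHierEstimator T y z lam v) ∧ ∀ v, IsHierEstimator T y z lam v →
      blockSupp v ⊆ blockSupp ϑ ∧ normInf2 (v - ϑ) ≤ 2 * D * (3 * hi + α / 8 * lo) ∧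
      μ * ‖v - ϑ‖ ≤ 2 * (3 * hi + α / 8 * lo) * √((blockSupp ϑ).ncard : ℝ) := by
  have hlam0 : ∀ b, 0 ≤ lam b := fun b => hlo.le.trans (hlam b)
  have hsup : ∀ v, blockSupp v ⊆ blockSupp ϑ → IsMinOn
      (fun x => empLoss T y z x + hierPenalty lam x) {x | blockSupp x ⊆ blockSupp ϑ} v →
      normInf2 (v - ϑ) ≤ 2 * D * (3 * hi + α / 8 * lo) := fun v hv hmin =>
    normInf2_sub_le hlam0 hhi hlamhi hlo.le (by positivity) hv subset_rfl hmin hg hD hη hηD hinv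
      hclose
  have hE : ∀ v, blockSupp v ⊆ blockSupp ϑ → IsMinOn
      (fun x => empLoss T y z x + hierPenalty lam x) {x | blockSupp x ⊆ blockSupp ϑ} v →
      ∀ b, ‖(gram T z (v - ϑ) - H (v - ϑ)) b‖ ≤ α / 8 * lo := fun v hv hmin b =>
    calc _ ≤ _ := norm_apply_le_normInf2 _ b
      _ ≤ η * normInf2 (v - ϑ) := hclose _ (blockSupp_sub_subset hv subset_rfl)
      _ ≤ η * (2 * D * (3 * hi + α / 8 * lo)) := mul_le_mul_of_nonneg_left (hsup v hv hmin) hη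
      _ ≤ _ := hηlo
  obtain ⟨v₀, hv₀, hmin₀⟩ := exists_isMinOn_restricted T y z hlo hlam (blockSupp ϑ)
  have hdom := objective_add_le hlam0 hv₀ hmin₀ (κ := α / 2) fun x hx =>
    inner_score_le_off hα hlo.le hlam hher hv₀ hmin₀ hg (hE v₀ hv₀ hmin₀) hinc hx
  refine ⟨⟨v₀, isMinOn_univ_iff.2 fun x => ?_⟩, fun v hv => ?_⟩
  · have h1 := hdom (x - v₀)
    rw [add_sub_cancel] at h1
    have h2 := mul_nonneg (half_pos hα).le (hierPenaltyOff_nonneg hlam0 (blockSupp ϑ) (x - v₀))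
    linarith
  · have hvS : blockSupp v ⊆ blockSupp ϑ := by
      -- the penalty of `v - v₀` off the support vanishes
      have h1 := hdom (v - v₀)
      rw [add_sub_cancel] at h1
      have h2 := isMinOn_univ_iff.1 hv v₀
      have h3 : hierPenaltyOff lam (blockSupp ϑ) (v - v₀) ≤ 0 := by
        by_contra! h
        have := mul_pos (half_pos hα) h
        linarith
      have h4 := mul_norm12_le_hierPenaltyOff hlo.le hlam hher
        (blockSupp_restr_subset (blockSupp ϑ)ᶜ (v - v₀))
      rw [hierPenaltyOff_restr_compl] at h4
      intro b hb
      by_contra hbS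
      have h5 : ‖v b‖ ≤ norm12 (restr (blockSupp ϑ)ᶜ (v - v₀)) := by
        refine le_trans (le_of_eq ?_)
          ((PiLp.norm_apply_le (restr (blockSupp ϑ)ᶜ (v - v₀)) b).trans (norm_le_norm12 _))
        rw [restr_of_mem (S := (blockSupp ϑ)ᶜ) hbS, PiLp.sub_apply, eq_zero_of_notMem hv₀ hbS,
          sub_zero]
      have h6 : 0 < ‖v b‖ := norm_pos_iff.2 hb
      have := mul_pos hlo (h6.trans_le h5)
      linarith
    have hmin : IsMinOn (fun x => empLoss T y z x + hierPenalty lam x)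
        {x | blockSupp x ⊆ blockSupp ϑ} v := hv.on_subset (Set.subset_univ _)
    exact ⟨hvS, hsup v hvS hmin, mul_norm_sub_le hlam0 hhi hlamhi hlo.le (by positivity) hvS
      subset_rfl hmin hg (hE v hvS hmin) (hμ _ (blockSupp_sub_subset hvS subset_rfl))⟩

/-! ### Concentration of the score -/

section Concentration

variable {Ω : Type*} {m mΩ : MeasurableSpace Ω} {P : Measure Ω} [IsProbabilityMeasure P]

/-- A bound on a conditional expectation can be used under the integral against any nonnegative
function that is measurable for the conditioning σ-algebra, without integrability. -/
lemma lintegral_mul_le_of_condExp_le (hm : m ≤ mΩ) {f : Ω → ℝ} (hf : Integrable f P)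
    (hf0 : ∀ ω, 0 ≤ f ω) {c : ℝ} (hfc : P[f | m] ≤ᵐ[P] fun _ => c)
    {h : Ω → ENNReal} (hh : Measurable[m] h) :
    ∫⁻ ω, h ω * ENNReal.ofReal (f ω) ∂P ≤ ENNReal.ofReal c * ∫⁻ ω, h ω ∂P := by
  have hfm : AEMeasurable (fun ω => ENNReal.ofReal (f ω)) P :=
    hf.aestronglyMeasurable.aemeasurable.ennreal_ofReal
  have hle : (P.withDensity fun ω => ENNReal.ofReal (f ω)).trim hm
      ≤ ENNReal.ofReal c • P.trim hm := by
    refine Measure.le_iff.2 fun A hA => ?_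
    rw [trim_measurableSet_eq hm hA, withDensity_apply _ (hm A hA), Measure.smul_apply,
      trim_measurableSet_eq hm hA, smul_eq_mul,
      ← ofReal_integral_eq_lintegral_ofReal hf.integrableOn (.of_forall hf0),
      ← setIntegral_condExp hm hf hA]
    have h1 : ∫ ω in A, (P[f | m]) ω ∂P ≤ ∫ _ in A, c ∂P :=
      setIntegral_mono_ae integrable_condExp.integrableOn (integrable_const c).integrableOn hfc
    rw [setIntegral_const, smul_eq_mul] at h1
    refine (ENNReal.ofReal_le_ofReal h1).trans ?_
    rw [ENNReal.ofReal_mul measureReal_nonneg, ofReal_measureReal, mul_comm]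
  calc ∫⁻ ω, h ω * ENNReal.ofReal (f ω) ∂P
      = ∫⁻ ω, h ω ∂(P.withDensity fun ω => ENNReal.ofReal (f ω)) := by
        rw [lintegral_withDensity_eq_lintegral_mul₀ hfm (hh.mono hm le_rfl).aemeasurable]
        simp only [Pi.mul_apply, mul_comm]
    _ = ∫⁻ ω, h ω ∂((P.withDensity fun ω => ENNReal.ofReal (f ω)).trim hm) :=
        (lintegral_trim hm hh).symm
    _ ≤ ∫⁻ ω, h ω ∂(ENNReal.ofReal c • P.trim hm) := lintegral_mono' hle le_rfl
    _ = ENNReal.ofReal c * ∫⁻ ω, h ω ∂P := by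
        rw [lintegral_smul_measure, lintegral_trim hm hh, smul_eq_mul]

/-- The exponential bound for the noise persists when the noise is multiplied by a predictable
weight in `[-1, 1]`: by convexity `exp (s w ξ)` lies below the chord between `exp (-s ξ)` and
`exp (s ξ)`. -/
lemma lintegral_mul_exp_le (hm : m ≤ mΩ) {ξ W : Ω → ℝ} {σ : ℝ}
    (hint : ∀ s : ℝ, Integrable (fun ω => Real.exp (s * ξ ω)) P)
    (hsub : ∀ s : ℝ, P[fun ω => Real.exp (s * ξ ω) | m] ≤ᵐ[P]
      fun _ => Real.exp (σ ^ 2 * s ^ 2 / 2))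
    (hWm : Measurable[m] W) (hW : ∀ᵐ ω ∂P, |W ω| ≤ 1) (s : ℝ)
    {h : Ω → ENNReal} (hh : Measurable[m] h) :
    ∫⁻ ω, h ω * ENNReal.ofReal (Real.exp (s * (W ω * ξ ω))) ∂P
      ≤ ENNReal.ofReal (Real.exp (σ ^ 2 * s ^ 2 / 2)) * ∫⁻ ω, h ω ∂P := by
  have hp : Measurable[m] fun ω => h ω * ENNReal.ofReal ((1 + W ω) / 2) :=
    hh.mul ((hWm.const_add 1).div_const 2).ennreal_ofReal
  have hn : Measurable[m] fun ω => h ω * ENNReal.ofReal ((1 - W ω) / 2) :=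
    hh.mul ((hWm.const_sub 1).div_const 2).ennreal_ofReal
  have h1 := lintegral_mul_le_of_condExp_le hm (hint s) (fun ω => (Real.exp_pos _).le)
    (hsub s) hp
  have h2 := lintegral_mul_le_of_condExp_le hm (hint (-s)) (fun ω => (Real.exp_pos _).le)
    (hsub (-s)) hn
  rw [neg_sq] at h2
  have hpm : AEMeasurable (fun ω => h ω * ENNReal.ofReal ((1 + W ω) / 2) *
      ENNReal.ofReal (Real.exp (s * ξ ω))) P :=
    (hp.mono hm le_rfl).aemeasurable.mul
      (hint s).aestronglyMeasurable.aemeasurable.ennreal_ofReal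
  calc ∫⁻ ω, h ω * ENNReal.ofReal (Real.exp (s * (W ω * ξ ω))) ∂P
      ≤ ∫⁻ ω, (h ω * ENNReal.ofReal ((1 + W ω) / 2) * ENNReal.ofReal (Real.exp (s * ξ ω)) +
          h ω * ENNReal.ofReal ((1 - W ω) / 2) * ENNReal.ofReal (Real.exp (-s * ξ ω))) ∂P := by
        refine lintegral_mono_ae ?_
        filter_upwards [hW] with ω hω
        have hp0 : 0 ≤ (1 + W ω) / 2 := by linarith [(abs_le.1 hω).1]
        have hn0 : 0 ≤ (1 - W ω) / 2 := by linarith [(abs_le.1 hω).2]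
        rw [mul_assoc, mul_assoc, ← mul_add, ← ENNReal.ofReal_mul hp0, ← ENNReal.ofReal_mul hn0,
          ← ENNReal.ofReal_add (mul_nonneg hp0 (Real.exp_pos _).le)
            (mul_nonneg hn0 (Real.exp_pos _).le)]
        refine mul_le_mul_right (ENNReal.ofReal_le_ofReal ?_) _
        have hc := convexOn_exp.2 (Set.mem_univ (s * ξ ω)) (Set.mem_univ (-s * ξ ω)) hp0 hn0
          (by ring)
        simp only [smul_eq_mul] at hc
        calc Real.exp (s * (W ω * ξ ω))
            = Real.exp ((1 + W ω) / 2 * (s * ξ ω) + (1 - W ω) / 2 * (-s * ξ ω)) := by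
              congr 1
              ring
          _ ≤ _ := hc
    _ ≤ ENNReal.ofReal (Real.exp (σ ^ 2 * s ^ 2 / 2)) *
          (∫⁻ ω, h ω * ENNReal.ofReal ((1 + W ω) / 2) ∂P +
            ∫⁻ ω, h ω * ENNReal.ofReal ((1 - W ω) / 2) ∂P) := by
        rw [lintegral_add_left' hpm, mul_add]
        exact add_le_add h1 h2
    _ = ENNReal.ofReal (Real.exp (σ ^ 2 * s ^ 2 / 2)) * ∫⁻ ω, h ω ∂P := by
        rw [← lintegral_add_left' (hp.mono hm le_rfl).aemeasurable]
        congr 1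
        refine lintegral_congr_ae ?_
        filter_upwards [hW] with ω hω
        have hp0 : 0 ≤ (1 + W ω) / 2 := by linarith [(abs_le.1 hω).1]
        have hn0 : 0 ≤ (1 - W ω) / 2 := by linarith [(abs_le.1 hω).2]
        rw [← mul_add, ← ENNReal.ofReal_add hp0 hn0]
        rw [show (1 + W ω) / 2 + (1 - W ω) / 2 = 1 by ring, ENNReal.ofReal_one, mul_one]

/-- Data of a martingale transform: predictable weights in `[-1, 1]` and conditionally
sub-Gaussian increments with variance proxy `σ²`. -/
structure IsSubGaussianTransform (P : Measure Ω) (ℱ : Filtration ℕ mΩ) (T : ℕ)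
    (W ξ : ℕ → Ω → ℝ) (σ : ℝ) : Prop where
  measurable_weight : ∀ t < T, Measurable[ℱ t] (W t)
  measurable_noise : ∀ t < T, Measurable[ℱ (t + 1)] (ξ t)
  weight_le : ∀ t < T, ∀ᵐ ω ∂P, |W t ω| ≤ 1
  integrable_exp : ∀ t < T, ∀ s : ℝ, Integrable (fun ω => Real.exp (s * ξ t ω)) P
  condExp_exp_le : ∀ t < T, ∀ s : ℝ,
    P[fun ω => Real.exp (s * ξ t ω) | ℱ t] ≤ᵐ[P] fun _ => Real.exp (σ ^ 2 * s ^ 2 / 2)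

variable {ℱ : Filtration ℕ mΩ} {T : ℕ} {W ξ : ℕ → Ω → ℝ} {σ : ℝ}

omit [IsProbabilityMeasure P] in
lemma IsSubGaussianTransform.neg (h : IsSubGaussianTransform P ℱ T W ξ σ) :
    IsSubGaussianTransform P ℱ T (fun t ω => -W t ω) ξ σ where
  measurable_weight t ht := (h.measurable_weight t ht).neg
  measurable_noise := h.measurable_noise
  weight_le t ht := by simpa only [abs_neg] using h.weight_le t ht
  integrable_exp := h.integrable_exp
  condExp_exp_le := h.condExp_exp_le

omit [IsProbabilityMeasure P] in
lemma IsSubGaussianTransform.measurable_sum (h : IsSubGaussianTransform P ℱ T W ξ σ) {n : ℕ}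
    (hn : n ≤ T) : Measurable[ℱ n] fun ω => ∑ t ∈ Finset.range n, W t ω * ξ t ω := by
  refine Finset.measurable_fun_sum _ fun t ht => ?_
  rw [Finset.mem_range] at ht
  exact ((h.measurable_weight t (by omega)).mono (ℱ.mono ht.le) le_rfl).mul
    ((h.measurable_noise t (by omega)).mono (ℱ.mono ht) le_rfl)

lemma IsSubGaussianTransform.lintegral_exp_le (h : IsSubGaussianTransform P ℱ T W ξ σ) (s : ℝ)
    {n : ℕ} (hn : n ≤ T) :
    ∫⁻ ω, ENNReal.ofReal (Real.exp (s * ∑ t ∈ Finset.range n, W t ω * ξ t ω)) ∂P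
      ≤ ENNReal.ofReal (Real.exp (σ ^ 2 * s ^ 2 / 2)) ^ n := by
  induction n with
  | zero => simp
  | succ n ih =>
    have hn' : n < T := hn
    have h1 := lintegral_mul_exp_le (ℱ.le n) (h.integrable_exp n hn') (h.condExp_exp_le n hn')
      (h.measurable_weight n hn') (h.weight_le n hn') s
      (((h.measurable_sum hn'.le).const_mul s).exp.ennreal_ofReal)
    simp only [Finset.sum_range_succ, mul_add, Real.exp_add,
      ENNReal.ofReal_mul (Real.exp_pos _).le]
    refine h1.trans ?_
    rw [pow_succ, mul_comm]
    exact mul_le_mul_left (ih hn'.le) _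

/-- Chernoff's bound with the optimal parameter `s = a / (T σ²)`. -/
lemma IsSubGaussianTransform.measure_le (h : IsSubGaussianTransform P ℱ T W ξ σ) (hT : 0 < T)
    (hσ : 0 < σ) {a : ℝ} (ha : 0 ≤ a) :
    P.real {ω | a ≤ ∑ t ∈ Finset.range T, W t ω * ξ t ω}
      ≤ Real.exp (-(a ^ 2 / (2 * T * σ ^ 2))) := by
  have hT' : (0 : ℝ) < T := Nat.cast_pos.2 hT
  set s : ℝ := a / (T * σ ^ 2) with hs
  have hs0 : 0 ≤ s := by positivity
  have hmeas : AEMeasurable (fun ω => ENNReal.ofReal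
      (Real.exp (s * ∑ t ∈ Finset.range T, W t ω * ξ t ω))) P :=
    ((((h.measurable_sum le_rfl).mono (ℱ.le T) le_rfl).const_mul s).exp.ennreal_ofReal).aemeasurable
  have h1 := (mul_meas_ge_le_lintegral₀ hmeas (ENNReal.ofReal (Real.exp (s * a)))).trans
    (h.lintegral_exp_le s le_rfl)
  have h2 : P {ω | a ≤ ∑ t ∈ Finset.range T, W t ω * ξ t ω} ≤
      P {ω | ENNReal.ofReal (Real.exp (s * a)) ≤ ENNReal.ofReal
        (Real.exp (s * ∑ t ∈ Finset.range T, W t ω * ξ t ω))} :=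
    measure_mono fun ω hω => ENNReal.ofReal_le_ofReal
      (Real.exp_le_exp.2 (mul_le_mul_of_nonneg_left hω hs0))
  have h3 := (mul_le_mul_right h2 (ENNReal.ofReal (Real.exp (s * a)))).trans h1
  rw [← ENNReal.ofReal_pow (Real.exp_pos _).le, ← Real.exp_nat_mul, ← ofReal_measureReal,
    ← ENNReal.ofReal_mul (Real.exp_pos _).le, ENNReal.ofReal_le_ofReal_iff (Real.exp_pos _).le,
    mul_comm, ← le_div_iff₀ (Real.exp_pos _), ← Real.exp_sub] at h3
  refine h3.trans_eq ?_
  congr 1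
  rw [hs]
  field_simp
  ring

lemma IsSubGaussianTransform.measure_abs_le (h : IsSubGaussianTransform P ℱ T W ξ σ)
    (hT : 0 < T) (hσ : 0 < σ) {a : ℝ} (ha : 0 ≤ a) :
    P.real {ω | a < |∑ t ∈ Finset.range T, W t ω * ξ t ω|}
      ≤ 2 * Real.exp (-(a ^ 2 / (2 * T * σ ^ 2))) := by
  have h1 := h.measure_le hT hσ ha
  have h2 := h.neg.measure_le hT hσ ha
  have h3 : {ω | a < |∑ t ∈ Finset.range T, W t ω * ξ t ω|} ⊆
      {ω | a ≤ ∑ t ∈ Finset.range T, W t ω * ξ t ω} ∪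
        {ω | a ≤ ∑ t ∈ Finset.range T, -W t ω * ξ t ω} := by
    intro ω hω
    have hω' : a < |∑ t ∈ Finset.range T, W t ω * ξ t ω| := hω
    rcases lt_abs.1 hω' with h | h
    · exact Or.inl h.le
    · refine Or.inr ?_
      simp only [neg_mul, Finset.sum_neg_distrib]
      exact h.le
  calc _ ≤ _ := measureReal_mono h3
    _ ≤ _ := measureReal_union_le _ _
    _ ≤ _ := by linarith

omit [IsProbabilityMeasure P] in
lemma IsSynergyModel.isSubGaussianTransform {y : ℕ → Ω → ℝ} {z : ℕ → Ω → Param M q}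
    {ϑ : Param M q} (h : IsSynergyModel P ℱ T y z ϑ σ) (b : Block M) (k : Fin q) :
    IsSubGaussianTransform P ℱ T (fun t ω => z t ω b k)
      (fun t ω => y t ω - inner ℝ ϑ (z t ω)) σ where
  measurable_weight t ht :=
    have hc : Continuous fun x : Param M q => x b k :=
      (PiLp.continuous_apply 2 _ k).comp (PiLp.continuous_apply 2 _ b)
    (hc.comp_stronglyMeasurable (h.measurable_feature t ht)).measurable
  measurable_noise t ht := by
    have h1 : StronglyMeasurable[ℱ (t + 1)] (z t) :=
      (h.measurable_feature t ht).mono (ℱ.mono t.le_succ)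
    have h2 : StronglyMeasurable[ℱ (t + 1)] fun ω => inner ℝ ϑ (z t ω) :=
      (continuous_const.inner continuous_id).comp_stronglyMeasurable h1
    exact ((h.measurable_response t ht).sub h2).measurable
  weight_le t ht := by
    filter_upwards [h.bounded_feature t ht] with ω hω
    exact (PiLp.norm_apply_le (z t ω b) k).trans (hω b)
  integrable_exp := h.noise_integrable
  condExp_exp_le := h.noise_subgaussian

lemma norm_le_of_coords {x : EuclideanSpace ℝ (Fin q)} {τ : ℝ} (h : ∀ k, |x k| ≤ τ) :
    ‖x‖ ≤ q * τ := by
  have h1 : ‖x‖ ≤ ∑ k, |x k| := by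
    refine (sq_le_sq₀ (norm_nonneg _) (Finset.sum_nonneg fun _ _ => abs_nonneg _)).1 ?_
    rw [PiLp.norm_sq_eq_of_L2]
    exact Finset.sum_sq_le_sq_sum_of_nonneg fun _ _ => abs_nonneg _
  refine h1.trans ((Finset.sum_le_sum fun k _ => h k).trans ?_)
  simp

/-- A union bound over all coordinates of all blocks. The threshold for a single coordinate is
`r / (q + 1)`, which also makes sense for `q = 0`. -/
lemma IsSynergyModel.measure_score_le {y : ℕ → Ω → ℝ} {z : ℕ → Ω → Param M q}
    {ϑ : Param M q} (h : IsSynergyModel P ℱ T y z ϑ σ) (hT : 0 < T) (hσ : 0 < σ) {r : ℝ}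
    (hr : 0 ≤ r) :
    P.real {ω | ¬ ∀ b, ‖score T (fun t => y t ω) (fun t => z t ω) ϑ b‖ ≤ r}
      ≤ Fintype.card (Block M) *
        (q * (2 * Real.exp (-(T * (r / (q + 1)) ^ 2 / (2 * σ ^ 2))))) := by
  have hT' : (0 : ℝ) < T := Nat.cast_pos.2 hT
  set τ : ℝ := r / (q + 1) with hτ
  have hτ0 : 0 ≤ τ := by positivity
  have hsub : {ω | ¬ ∀ b, ‖score T (fun t => y t ω) (fun t => z t ω) ϑ b‖ ≤ r} ⊆
      ⋃ b, ⋃ k, {ω | T * τ <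
        |∑ t ∈ Finset.range T, z t ω b k * (y t ω - inner ℝ ϑ (z t ω))|} := by
    intro ω hω
    by_contra hc
    simp only [Set.mem_iUnion, Set.mem_ofPred_eq, not_exists, not_lt] at hc
    refine hω fun b => ?_
    have h1 : ∀ k, |score T (fun t => y t ω) (fun t => z t ω) ϑ b k| ≤ τ := fun k => by
      have h2 : score T (fun t => y t ω) (fun t => z t ω) ϑ b k = (T : ℝ)⁻¹ *
          ∑ t ∈ Finset.range T, z t ω b k * (y t ω - inner ℝ ϑ (z t ω)) := by
        simp [score, mul_comm]
      rw [h2, abs_mul, abs_of_pos (inv_pos.2 hT'), inv_mul_le_iff₀ hT']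
      exact hc b k
    refine (norm_le_of_coords h1).trans ?_
    rw [hτ, mul_div_assoc', div_le_iff₀ (by positivity)]
    nlinarith
  have hbk : ∀ (b : Block M) (k : Fin q), P.real {ω | T * τ <
      |∑ t ∈ Finset.range T, z t ω b k * (y t ω - inner ℝ ϑ (z t ω))|}
        ≤ 2 * Real.exp (-(T * τ ^ 2 / (2 * σ ^ 2))) := fun b k => by
    refine ((h.isSubGaussianTransform b k).measure_abs_le hT hσ
      (mul_nonneg hT'.le hτ0)).trans_eq ?_
    congr 3
    field_simp
  calc _ ≤ _ := measureReal_mono hsub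
    _ ≤ ∑ b : Block M, ∑ k : Fin q, 2 * Real.exp (-(T * τ ^ 2 / (2 * σ ^ 2))) :=
      (measureReal_iUnion_fintype_le _).trans (Finset.sum_le_sum fun b _ =>
        (measureReal_iUnion_fintype_le _).trans (Finset.sum_le_sum fun k _ => hbk b k))
    _ = _ := by simp

end Concentration

/-! ### The noise level and recovery with high probability -/

lemma card_block_le (M : ℕ) : Fintype.card (Block M) ≤ 2 * M ^ 2 := by
  have h1 : Fintype.card {p : Fin M × Fin M // p.1 < p.2} ≤ M * M := by
    simpa using Fintype.card_subtype_le fun p : Fin M × Fin M => p.1 < p.2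
  rw [Fintype.card_sum, Fintype.card_fin]
  nlinarith [Nat.le_mul_self M]

/-- The exponent in the noise bound: a deviation constant at which the union bound over at most
`2 M²` blocks with `q` coordinates each stays below `δ`, uniformly in `M ≥ 2`. -/
noncomputable def noiseExponent (q : ℕ) (δ : ℝ) : ℝ := 2 + Real.log (4 * (q + 1) / δ) / Real.log 2

lemma noiseExponent_pos {q : ℕ} {δ : ℝ} (hδ : 0 < δ) (hδ1 : δ < 1) : 0 < noiseExponent q δ := by
  have h1 : 1 ≤ 4 * ((q : ℝ) + 1) / δ := by
    rw [le_div_iff₀ hδ]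
    have : (0 : ℝ) ≤ q := q.cast_nonneg
    linarith
  have := div_nonneg (Real.log_nonneg h1) (Real.log_nonneg one_le_two)
  unfold noiseExponent
  linarith

lemma union_bound_le {q M : ℕ} {δ : ℝ} (hδ : 0 < δ) (hδ1 : δ < 1) (hM : 2 ≤ M) :
    Fintype.card (Block M) * (q * (2 * Real.exp (-(noiseExponent q δ * Real.log M)))) ≤ δ := by
  have hM' : (2 : ℝ) ≤ M := by exact_mod_cast hM
  have hM0 : (0 : ℝ) < M := by linarith
  have hq : (0 : ℝ) ≤ q := q.cast_nonneg
  have hcard : (Fintype.card (Block M) : ℝ) ≤ 2 * M ^ 2 := by exact_mod_cast card_block_le M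
  have hlog2 : 0 < Real.log 2 := Real.log_pos one_lt_two
  have hlog : Real.log 2 ≤ Real.log M := Real.log_le_log two_pos hM'
  set L := Real.log (4 * (q + 1) / δ) with hL
  have hL0 : 0 ≤ L := by
    refine Real.log_nonneg ?_
    rw [le_div_iff₀ hδ]
    linarith
  have h1 : Real.exp (-(noiseExponent q δ * Real.log M)) ≤ (M ^ 2 : ℝ)⁻¹ * (δ / (4 * (q + 1))) := by
    have h2 : L ≤ L / Real.log 2 * Real.log M := by
      rw [div_mul_eq_mul_div, le_div_iff₀ hlog2]
      exact mul_le_mul_of_nonneg_left hlog hL0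
    calc Real.exp (-(noiseExponent q δ * Real.log M))
        ≤ Real.exp (-(2 * Real.log M) + -L) := by
          refine Real.exp_le_exp.2 ?_
          unfold noiseExponent
          rw [← hL]
          linarith
      _ = (M ^ 2 : ℝ)⁻¹ * (δ / (4 * (q + 1))) := by
          rw [Real.exp_add, Real.exp_neg, Real.exp_neg, hL, Real.exp_log (by positivity), inv_div,
            two_mul, Real.exp_add, Real.exp_log hM0, sq]
  calc Fintype.card (Block M) * (q * (2 * Real.exp (-(noiseExponent q δ * Real.log M))))
      ≤ 2 * M ^ 2 * (q * (2 * ((M ^ 2 : ℝ)⁻¹ * (δ / (4 * (q + 1)))))) := by gcongr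
    _ = q / (q + 1) * δ := by field_simp; ring
    _ ≤ 1 * δ := by
        gcongr
        rw [div_le_one (by positivity)]
        linarith
    _ = δ := one_mul δ

end SparseSynergy

theorem theorem9 (q : ℕ) (σ δ α : ℝ) (hσ : 0 < σ) (hδ : 0 < δ) (hδ1 : δ < 1)
    (hα : 0 < α) (hα1 : α ≤ 1) :
    ∃ c₀ : ℝ, 0 < c₀ ∧ ∀ A : ℝ, c₀ ≤ A → ∀ μ : ℝ, 0 < μ →
    ∃ C : ℝ, 0 < C ∧ ∀ D ρ : ℝ, 0 < D → 0 < ρ →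
    ∃ C₁ C₂ η : ℝ, 0 < C₁ ∧ 0 < C₂ ∧ 0 < η ∧
    ∀ (M T k₁ k₂ : ℕ), 2 ≤ M → 1 ≤ T →
    ∀ (Ω : Type*) (mΩ : MeasurableSpace Ω) (P : Measure Ω), IsProbabilityMeasure P →
    ∀ (ℱ : Filtration ℕ mΩ) (y : ℕ → Ω → ℝ) (z : ℕ → Ω → Param M q)
      (ϑ : Param M q) (lam : Block M → ℝ) (δH : ℝ),
    IsSynergyModel P ℱ T y z ϑ σ →
    Heredity ϑ →
    (mainSupp ϑ).ncard = k₁ →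
    (interSupp ϑ).ncard = k₂ →
    (∀ b, c₀ * √(Real.log M / T) ≤ lam b ∧ lam b ≤ A * √(Real.log M / T)) →
    HierRSC (popLoss P T y z) ϑ lam μ →
    HierIncoherent (hess (popLoss P T y z) ϑ)
      (blockSupp ϑ) lam α →
    InvBound (hess (popLoss P T y z) ϑ)
      (blockSupp ϑ) D →
    1 - δH ≤ P.real {ω | HessClose
      (hess (empLoss T (fun t => y t ω) (fun t => z t ω)) ϑ)
      (hess (popLoss P T y z) ϑ) (blockSupp ϑ) η} →
    (∀ b ∈ blockSupp ϑ, C₂ * √(Real.log M / T) ≤ ‖ϑ b‖) →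
    C₁ * ((k₁ + k₂ : ℝ) * Real.log M) ≤ T →
    1 - δ - δH ≤ P.real {ω |
      (∃ ϑhat, IsHierEstimator T (fun t => y t ω) (fun t => z t ω) lam ϑhat) ∧
      ∀ ϑhat, IsHierEstimator T (fun t => y t ω) (fun t => z t ω) lam ϑhat →
        mainSupp ϑhat = mainSupp ϑ ∧
        interSupp ϑhat = interSupp ϑ ∧
        ‖ϑhat - ϑ‖ ≤ C * √((k₁ + k₂ : ℝ) * Real.log M / T) ∧
        (∀ (V : Param M q → ℝ) (LV : ℝ), 0 < LV →
          (∀ ϑ', ‖ϑ' - ϑ‖ < ρ → |V ϑ' - V ϑ| ≤ LV * ‖ϑ' - ϑ‖) →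
          V ϑ - V ϑhat ≤ LV * C * √((k₁ + k₂ : ℝ) * Real.log M / T)) ∧
        (∀ (V : Param M q → ℝ) (LV : ℝ), 0 < LV →
          (∀ ϑ', ‖ϑ' - ϑ‖ < ρ → |V ϑ' - V ϑ| ≤ LV * norm12 (ϑ' - ϑ)) →
          V ϑ - V ϑhat ≤ LV * C * ((k₁ + k₂ : ℝ) * √(Real.log M / T)))} := by
  have hK := noiseExponent_pos (q := q) hδ hδ1
  set K := noiseExponent q δ
  -- `c₀` makes `(α c₀ / (8 (q + 1)))² / (2 σ²)` equal to the noise exponent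
  set c₀ : ℝ := 8 * (q + 1) / α * (σ * √(2 * K)) with hc₀
  have hc₀pos : 0 < c₀ := by positivity
  refine ⟨c₀, hc₀pos, fun A hA μ hμ => ?_⟩
  have hApos : 0 < A := hc₀pos.trans_le hA
  set B : ℝ := 3 * A + α / 8 * c₀ with hB
  have hBpos : 0 < B := by positivity
  set C : ℝ := 2 * B / μ with hC
  have hCpos : 0 < C := by positivity
  refine ⟨C, hCpos, fun D ρ hD hρ => ?_⟩
  set η : ℝ := α / 8 * c₀ / (2 * D * B) with hη
  have hηpos : 0 < η := by positivity
  refine ⟨(2 * C / ρ) ^ 2, 2 * D * B + 1, η, by positivity, by positivity, hηpos, ?_⟩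
  intro M T k₁ k₂ hM hT Ω mΩ P hP ℱ y z ϑ lam δH hmodel hher hk₁ hk₂ hlam hrsc hinc hinv hclose
    hbeta hTk
  have hM' : (2 : ℝ) ≤ M := by exact_mod_cast hM
  have hT' : (0 : ℝ) < T := by exact_mod_cast hT
  have hlogM : 0 < Real.log M := Real.log_pos (by linarith)
  set l : ℝ := √(Real.log M / T) with hl
  have hlpos : 0 < l := Real.sqrt_pos.2 (by positivity)
  have hl2 : l ^ 2 = Real.log M / T := Real.sq_sqrt (by positivity)
  have hk0 : (0 : ℝ) ≤ k₁ + k₂ := by positivity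
  have hcard : ((blockSupp ϑ).ncard : ℝ) = k₁ + k₂ := by
    rw [ncard_blockSupp, hk₁, hk₂]; push_cast; rfl
  have hsqrt : √((k₁ + k₂ : ℝ) * Real.log M / T) = √(k₁ + k₂ : ℝ) * l := by
    rw [mul_div_assoc, Real.sqrt_mul hk0]
  have hCρ : C * √((k₁ + k₂ : ℝ) * Real.log M / T) < ρ := by
    have h1 : √((k₁ + k₂ : ℝ) * Real.log M / T) ≤ ρ / (2 * C) := by
      refine Real.sqrt_le_iff.2 ⟨by positivity, ?_⟩
      rw [div_le_iff₀ hT']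
      calc (k₁ + k₂ : ℝ) * Real.log M
          = (ρ / (2 * C)) ^ 2 * ((2 * C / ρ) ^ 2 * ((k₁ + k₂ : ℝ) * Real.log M)) := by
            field_simp
        _ ≤ _ := mul_le_mul_of_nonneg_left hTk (by positivity)
    calc C * √((k₁ + k₂ : ℝ) * Real.log M / T) ≤ C * (ρ / (2 * C)) :=
          mul_le_mul_of_nonneg_left h1 hCpos.le
      _ = ρ / 2 := by field_simp
      _ < ρ := half_lt_self hρ
  have hlam0 : ∀ b, 0 ≤ lam b := fun b => (by positivity : 0 ≤ c₀ * l).trans (hlam b).1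
  -- the event on which the score is small
  have hnoise : P.real {ω | ¬ ∀ b, ‖score T (fun t => y t ω) (fun t => z t ω) ϑ b‖
      ≤ α / 8 * (c₀ * l)} ≤ δ := by
    refine (hmodel.measure_score_le hT hσ (by positivity)).trans ?_
    refine le_trans (le_of_eq ?_) (union_bound_le (q := q) hδ hδ1 hM)
    congr 5
    have h1 : α / 8 * (c₀ * l) / (q + 1) = σ * √(2 * K) * l := by
      rw [hc₀]; field_simp
    rw [h1, mul_pow, mul_pow, hl2, Real.sq_sqrt (by positivity)]
    field_simp
    rfl
  -- no measurability is needed to intersect the two good events: outer measures are subadditive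
  have hunion : ∀ G : Set Ω, {ω | HessClose
      (hess (empLoss T (fun t => y t ω) (fun t => z t ω)) ϑ)
      (hess (popLoss P T y z) ϑ) (blockSupp ϑ) η} ⊆
        G ∪ {ω | ¬ ∀ b, ‖score T (fun t => y t ω) (fun t => z t ω) ϑ b‖ ≤ α / 8 * (c₀ * l)} →
      1 - δ - δH ≤ P.real G := fun G hG => by
    have h1 := (measureReal_mono hG).trans (measureReal_union_le (μ := P) _ _)
    linarith
  refine hunion _ ?_
  intro ω hω
  rw [Set.mem_union, or_iff_not_imp_right]
  intro hscore
  have hg : ∀ b, ‖score T (fun t => y t ω) (fun t => z t ω) ϑ b‖ ≤ α / 8 * (c₀ * l) :=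
    not_not.1 hscore
  have hcl : HessClose (gram T fun t => z t ω) (hess (popLoss P T y z) ϑ) (blockSupp ϑ) η := by
    rw [← hess_empLoss T (fun t => y t ω) (fun t => z t ω) ϑ]
    exact hω
  have hBl : 3 * (A * l) + α / 8 * (c₀ * l) = B * l := by rw [hB]; ring
  have hηB : η * (2 * D * B) = α / 8 * c₀ := div_mul_cancel₀ _ (by positivity)
  obtain ⟨hex, hall⟩ := recovery_of_small_score (μ := μ) (lo := c₀ * l) (hi := A * l) hα
    (by positivity) (fun b => (hlam b).1) (by positivity) (fun b => (hlam b).2) hD.le hηpos.le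
    (by
      rw [hη, mul_div_assoc', div_le_iff₀ (by positivity)]
      nlinarith [mul_pos hD hApos])
    (by
      rw [hBl]
      refine le_of_eq ?_
      linear_combination l * hηB)
    hher hg hinv hcl hinc (fun Δ hΔ => hrsc.mul_sq_norm_le hlam0 hmodel.popLoss_eq_taylor hΔ)
  refine ⟨hex, fun v hv => ?_⟩
  obtain ⟨hsupp, hinf, htwo⟩ := hall v hv
  rw [hBl] at hinf htwo
  rw [hcard] at htwo
  -- the signal strength exceeds the blockwise error, so no active block is lost
  have hne : ∀ b, v b ≠ 0 ↔ ϑ b ≠ 0 := fun b => by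
    refine ⟨fun h => hsupp h, fun h h0 => ?_⟩
    have h1 := norm_apply_le_normInf2 (v - ϑ) b
    rw [PiLp.sub_apply, h0, zero_sub, norm_neg] at h1
    have h2 := hbeta b h
    linarith
  have herr : ‖v - ϑ‖ ≤ C * √((k₁ + k₂ : ℝ) * Real.log M / T) := by
    rw [hsqrt, hC, div_mul_eq_mul_div, le_div_iff₀ hμ]
    linarith
  have herr12 : norm12 (v - ϑ) ≤ C * ((k₁ + k₂ : ℝ) * l) := by
    have h1 := norm12_le_sqrt_ncard_mul (blockSupp_sub_subset hsupp subset_rfl)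
    rw [hcard] at h1
    rw [hsqrt] at herr
    calc norm12 (v - ϑ) ≤ √(k₁ + k₂ : ℝ) * (C * (√(k₁ + k₂ : ℝ) * l)) :=
          h1.trans (mul_le_mul_of_nonneg_left herr (Real.sqrt_nonneg _))
      _ = C * (√(k₁ + k₂ : ℝ) * √(k₁ + k₂ : ℝ) * l) := by ring
      _ = C * ((k₁ + k₂ : ℝ) * l) := by rw [Real.mul_self_sqrt hk0]
  refine ⟨Set.ext fun i => hne _, Set.ext fun p => hne _, herr, fun V LV hLV hV => ?_,
    fun V LV hLV hV => ?_⟩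
  · have h1 := (neg_le_abs _).trans (hV v (herr.trans_lt hCρ))
    have h2 := mul_le_mul_of_nonneg_left herr hLV.le
    linarith
  · have h1 := (neg_le_abs _).trans (hV v (herr.trans_lt hCρ))
    have h2 := mul_le_mul_of_nonneg_left herr12 hLV.le
    linarith
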